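/- Let $(M,g)$ be a smooth Riemannian surface, $I\subset\mathbb{R}$ a non-degenerate interval, and $\gamma\colon I\to M$ a smooth curve parametrized by arclength, with $T=\gamma'$. The geodesic curvature $k\colon I\to\mathbb{R}$ of $\gamma$ is defined, up to the choice of a smooth unit normal field $N$ along $\gamma$, by $\nabla_TT=kN$. With $\tau=\nabla_TT$ and $R(X,Y)Z=\nabla_X\nabla_YZ-\nabla_Y\nabla_XZ-\nabla_{[X,Y]}Z$, the curve $\gamma$ is called *$\tfrac12$-biharmonic* if $\tau$ vanishes nowhere and $\gamma$ satisfies the Euler–Lagrange equation $$\nabla_T\nabla_T\big(|\tau|^{-3/2}\tau\big)-|\tau|^{-3/2}R(T,\tau)T=0$$ of the energy $2\int_I|\nabla_{\gamma'}\gamma'|^{1/2}\,ds$; it is called *proper $\tfrac12$-biharmonic* if in addition its geodesic curvature is not constant. **Theorem.** 1. If $M=\mathbb{R}^2$ with the flat metric ($K=0$), then $\gamma$ is proper $\tfrac12$-biharmonic if its geodesic curvature (for some choice of $N$) is $$k(s)=\frac{c_1}{c_1^2(c_2+s)^2+1},\qquad c_1,c_2\in\mathbb{R},\ c_1\neq0.$$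 2. If $M=\mathbb{S}^2$ with the round metric of curvature $K=1$, then $\gamma$ is proper $\tfrac12$-biharmonic if its geodesic curvature is $$k(s)=\frac{2}{c_1+\sqrt{c_1^2-4}\,\sin 2(c_3+s)},\qquad c_1,c_3\in\mathbb{R},\ c_1^2>4.$$ 3. If $M$ is a surface with a metric of constant Gauss curvature $K=-1$, then $\gamma$ is proper $\tfrac12$-biharmonic if its geodesic curvature is $$k(s)=\frac{4e^{2(c_4+s)}}{(c_1-e^{2(c_4+s)})^2+4},\qquad c_1,c_4\in\mathbb{R}.$$ Moreover, in each case the function $k$, considered on all of $\mathbb{R}$, is smooth and solves $\tfrac34k'^2-\tfrac12kk''-k^4+Kk^2=0$ with the respective value of $K$. -/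

import Mathlib

open scoped Manifold ContDiff

universe u

noncomputable section

/-! ### Riemannian metrics -/

/-- A smooth Riemannian metric on an `n`-dimensional smooth manifold `M` without boundary. -/
abbrev SmoothRiemannianMetric (n : ℕ) (M : Type*) [TopologicalSpace M]
    [ChartedSpace (EuclideanSpace ℝ (Fin n)) M] [IsManifold (𝓡 n) ∞ M] :=
  Bundle.ContMDiffRiemannianMetric (𝓡 n) ∞ (EuclideanSpace ℝ (Fin n))
    (fun x : M => TangentSpace (𝓡 n) x)

/-- The flat metric of the Euclidean plane. -/
def flatMetric : SmoothRiemannianMetric 2 (EuclideanSpace ℝ (Fin 2)) where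
  inner _ := (innerSL ℝ : EuclideanSpace ℝ (Fin 2) →L[ℝ] EuclideanSpace ℝ (Fin 2) →L[ℝ] ℝ)
  symm := (riemannianMetricVectorSpace (EuclideanSpace ℝ (Fin 2))).symm
  pos := (riemannianMetricVectorSpace (EuclideanSpace ℝ (Fin 2))).pos
  isVonNBounded := (riemannianMetricVectorSpace (EuclideanSpace ℝ (Fin 2))).isVonNBounded
  contMDiff :=
    (riemannianMetricVectorSpace (EuclideanSpace ℝ (Fin 2))).contMDiff.of_le (by simp)

/-- The unit sphere `S²` in `ℝ³`. -/
abbrev TwoSphere := Metric.sphere (0 : EuclideanSpace ℝ (Fin 3)) 1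

/-- The differential at `x` of the inclusion of `S²` into `ℝ³`. -/
def sphereInclusionDeriv (x : TwoSphere) :
    TangentSpace (𝓡 2) x →L[ℝ] EuclideanSpace ℝ (Fin 3) :=
  mvfderiv (𝓡 2) (fun y : TwoSphere => (y : EuclideanSpace ℝ (Fin 3))) x

/-- The bilinear form `(v, w) ↦ ⟪A v, A w⟫`. -/
def pullbackInner (A : EuclideanSpace ℝ (Fin 2) →L[ℝ] EuclideanSpace ℝ (Fin 3)) :
    EuclideanSpace ℝ (Fin 2) →L[ℝ] EuclideanSpace ℝ (Fin 2) →L[ℝ] ℝ :=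
  (innerSL ℝ : EuclideanSpace ℝ (Fin 3) →L[ℝ] EuclideanSpace ℝ (Fin 3) →L[ℝ] ℝ).bilinearComp A A

theorem contDiff_pullbackInner : ContDiff ℝ ∞ pullbackInner := by
  have : pullbackInner = fun A => ((ContinuousLinearMap.compL ℝ _ _ _).flip A) ∘L
      ((innerSL ℝ : EuclideanSpace ℝ (Fin 3) →L[ℝ] EuclideanSpace ℝ (Fin 3) →L[ℝ] ℝ) ∘L A) := by
    rfl
  rw [this]
  fun_prop

theorem sphereInclusionDeriv_injective (x : TwoSphere) :
    Function.Injective (sphereInclusionDeriv x) := by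
  have := Fact.mk (@finrank_euclideanSpace_fin ℝ _ (2 + 1))
  exact injective_mvfderiv_subtypeVal_sphere (n := 2) x

/-- The inner product on the tangent space of `S²` at `x` induced from `ℝ³`. -/
def roundInner (x : TwoSphere) :
    TangentSpace (𝓡 2) x →L[ℝ] TangentSpace (𝓡 2) x →L[ℝ] ℝ :=
  pullbackInner (sphereInclusionDeriv x)

/-- The round metric of `S²`: the metric induced from the Euclidean metric of `ℝ³`. -/
def roundMetric : SmoothRiemannianMetric 2 TwoSphere where
  inner := roundInner
  symm x v w := real_inner_comm (sphereInclusionDeriv x w) (sphereInclusionDeriv x v)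
  pos x v hv := real_inner_self_pos.2
    (fun h => hv (sphereInclusionDeriv_injective x (h.trans (map_zero _).symm)))
  isVonNBounded x := by
    let A : EuclideanSpace ℝ (Fin 2) →L[ℝ] EuclideanSpace ℝ (Fin 3) := sphereInclusionDeriv x
    obtain ⟨K, hK, hA⟩ := A.toLinearMap.exists_antilipschitzWith
      (LinearMap.ker_eq_bot.2 (sphereInclusionDeriv_injective x))
    have : {v : EuclideanSpace ℝ (Fin 2) | inner ℝ (A v) (A v) < 1} ⊆ Metric.closedBall 0 K := by
      intro v h1
      rw [Set.mem_ofPred_eq, real_inner_self_eq_norm_sq] at h1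
      have h2 : ‖A v‖ ≤ 1 := by nlinarith [norm_nonneg (A v)]
      have h3 : dist v 0 ≤ K * dist (A v) (A 0) := hA.le_mul_dist v 0
      rw [map_zero, dist_zero_right, dist_zero_right] at h3
      have h4 : (K : ℝ) * ‖A v‖ ≤ K * 1 := by gcongr
      rw [mem_closedBall_zero_iff]
      linarith
    have h := (NormedSpace.isVonNBounded_closedBall ℝ (EuclideanSpace ℝ (Fin 2)) K).subset this
    exact h
  contMDiff := by
    intro x
    rw [Bundle.contMDiffAt_section]
    have := Fact.mk (@finrank_euclideanSpace_fin ℝ _ (2 + 1))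
    have h := (contMDiff_coe_sphere (n := 2) (m := ∞)
      (E := EuclideanSpace ℝ (Fin 3)) x).mfderiv_const (m := ∞) (by simp)
    refine (contDiff_pullbackInner.contMDiff.contMDiffAt.comp x h).congr_of_eventuallyEq ?_
    have hU : (trivializationAt (EuclideanSpace ℝ (Fin 2) →L[ℝ] ℝ)
        (fun x : TwoSphere => TangentSpace (𝓡 2) x →L[ℝ] ℝ) x).baseSet ∈ nhds x :=
      (trivializationAt (EuclideanSpace ℝ (Fin 2) →L[ℝ] ℝ)
        (fun x : TwoSphere => TangentSpace (𝓡 2) x →L[ℝ] ℝ) x).open_baseSet.mem_nhds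
        (FiberBundle.mem_baseSet_trivializationAt' x)
    filter_upwards [hU] with y hy
    ext v w
    rw [hom_trivializationAt_apply, ContinuousLinearMap.inCoordinates]
    simp only [ContinuousLinearMap.comp_apply]
    rw [Bundle.Trivialization.continuousLinearMapAt_apply,
      Bundle.Trivialization.linearMapAt_apply, if_pos hy, hom_trivializationAt_apply,
      ContinuousLinearMap.inCoordinates]
    simp [inTangentCoordinates, ContinuousLinearMap.inCoordinates, pullbackInner]
    rfl

/-! ### Levi-Civita connection and curvature in a chart

Here `φ` is a chart of `M`; the functions below are meaningful at points `y` of its target. -/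

section Charts

variable {n : ℕ} {M : Type u} [TopologicalSpace M] [ChartedSpace (EuclideanSpace ℝ (Fin n)) M]
  [IsManifold (𝓡 n) ∞ M]

/-- The partial derivative `∂ᵢ f` at `y`. -/
def partialDeriv (i : Fin n) (f : EuclideanSpace ℝ (Fin n) → ℝ) (y : EuclideanSpace ℝ (Fin n)) :
    ℝ :=
  fderiv ℝ f y (EuclideanSpace.single i 1)

/-- The coordinate vector field `∂ᵢ` of the chart `φ`, at the point with coordinates `y`. -/
def coordField (φ : OpenPartialHomeomorph M (EuclideanSpace ℝ (Fin n)))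
    (y : EuclideanSpace ℝ (Fin n)) (i : Fin n) : TangentSpace (𝓡 n) (φ.symm y) :=
  mfderiv (𝓡 n) (𝓡 n) φ.symm y (EuclideanSpace.single i (1 : ℝ) : EuclideanSpace ℝ (Fin n))

/-- The coefficients `gᵢⱼ = g(∂ᵢ, ∂ⱼ)` of the metric in the chart `φ`. -/
def metricCoeff (g : SmoothRiemannianMetric n M)
    (φ : OpenPartialHomeomorph M (EuclideanSpace ℝ (Fin n))) (y : EuclideanSpace ℝ (Fin n)) :
    Matrix (Fin n) (Fin n) ℝ :=
  Matrix.of fun i j => g.inner (φ.symm y) (coordField φ y i) (coordField φ y j)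

/-- The Christoffel symbols of the Levi-Civita connection,
`Γᵏᵢⱼ = ½ ∑ₗ gᵏˡ (∂ᵢ gⱼₗ + ∂ⱼ gᵢₗ - ∂ₗ gᵢⱼ)`. -/
def christoffel (g : SmoothRiemannianMetric n M)
    (φ : OpenPartialHomeomorph M (EuclideanSpace ℝ (Fin n))) (k i j : Fin n)
    (y : EuclideanSpace ℝ (Fin n)) : ℝ :=
  1 / 2 * ∑ l, (metricCoeff g φ y)⁻¹ k l *
    (partialDeriv i (fun z => metricCoeff g φ z j l) y
      + partialDeriv j (fun z => metricCoeff g φ z i l) y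
      - partialDeriv l (fun z => metricCoeff g φ z i j) y)

/-- The components of the Riemann curvature tensor
`R(X, Y) Z = ∇_X ∇_Y Z - ∇_Y ∇_X Z - ∇_[X, Y] Z`, normalised by `R(∂ᵢ, ∂ⱼ) ∂ₖ = ∑ₗ Rˡᵢⱼₖ ∂ₗ`. -/
def riemannCoeff (g : SmoothRiemannianMetric n M)
    (φ : OpenPartialHomeomorph M (EuclideanSpace ℝ (Fin n))) (l i j k : Fin n)
    (y : EuclideanSpace ℝ (Fin n)) : ℝ :=
  partialDeriv i (christoffel g φ l j k) y - partialDeriv j (christoffel g φ l i k) y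
    + ∑ m, (christoffel g φ l i m y * christoffel g φ m j k y
      - christoffel g φ l j m y * christoffel g φ m i k y)

/-- The components of `R(X, Y) Z` for vectors `X`, `Y`, `Z` given by their components. -/
def riemannApply (g : SmoothRiemannianMetric n M)
    (φ : OpenPartialHomeomorph M (EuclideanSpace ℝ (Fin n))) (y : EuclideanSpace ℝ (Fin n))
    (X Y Z : Fin n → ℝ) : Fin n → ℝ :=
  fun l => ∑ i, ∑ j, ∑ k, riemannCoeff g φ l i j k y * X i * Y j * Z k

/-- The length of the vector with components `V`. -/
def coordNorm (g : SmoothRiemannianMetric n M)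
    (φ : OpenPartialHomeomorph M (EuclideanSpace ℝ (Fin n))) (y : EuclideanSpace ℝ (Fin n))
    (V : Fin n → ℝ) : ℝ :=
  Real.sqrt (∑ i, ∑ j, metricCoeff g φ y i j * V i * V j)

/-! ### Curves

A curve is a map `γ : ℝ → M` considered on an interval `I`; all derivatives with respect to the
curve parameter are derivatives within `I`. -/

/-- The velocity `γ'(s)`. -/
def velocity (γ : ℝ → M) (I : Set ℝ) (s : ℝ) : TangentSpace (𝓡 n) (γ s) :=
  mfderivWithin 𝓘(ℝ, ℝ) (𝓡 n) γ I s (1 : ℝ)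

/-- `γ` is a smooth curve on the (non-degenerate) interval `I`, parametrised by arclength. -/
structure IsArclengthCurve (g : SmoothRiemannianMetric n M) (γ : ℝ → M) (I : Set ℝ) : Prop where
  ordConnected : I.OrdConnected
  nontrivial : I.Nontrivial
  smooth : ContMDiffOn 𝓘(ℝ, ℝ) (𝓡 n) ∞ γ I
  unit_speed : ∀ s ∈ I, g.inner (γ s) (velocity γ I s) (velocity γ I s) = 1

/-- The components of `γ'(s)` in the chart `φ`. -/
def coordVelocity (φ : OpenPartialHomeomorph M (EuclideanSpace ℝ (Fin n))) (γ : ℝ → M)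
    (I : Set ℝ) (s : ℝ) : Fin n → ℝ :=
  fun i => derivWithin (fun t => φ (γ t) i) I s

/-- The components in the chart `φ` of the covariant derivative `∇_{γ'} V` of a vector field along
`γ` with components `V`: `(∇_{γ'} V)ᵏ = (Vᵏ)' + ∑ᵢⱼ Γᵏᵢⱼ (γⁱ)' Vʲ`. -/
def covDerivAlong (g : SmoothRiemannianMetric n M)
    (φ : OpenPartialHomeomorph M (EuclideanSpace ℝ (Fin n))) (γ : ℝ → M) (I : Set ℝ)
    (V : ℝ → Fin n → ℝ) (s : ℝ) : Fin n → ℝ :=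
  fun k => derivWithin (fun t => V t k) I s
    + ∑ i, ∑ j, christoffel g φ k i j (φ (γ s)) * coordVelocity φ γ I s i * V s j

/-- The components in the chart `φ` of the tension field `τ(γ) = ∇_{γ'} γ'`. -/
def coordTension (g : SmoothRiemannianMetric n M)
    (φ : OpenPartialHomeomorph M (EuclideanSpace ℝ (Fin n))) (γ : ℝ → M) (I : Set ℝ) :
    ℝ → Fin n → ℝ :=
  covDerivAlong g φ γ I (coordVelocity φ γ I)

/-- `γ` is a `p`-biharmonic curve without geodesic points: `τ = ∇_{γ'} γ'` vanishes nowhere and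
`∇_{γ'} ∇_{γ'} (|τ|^(p-2) τ) - |τ|^(p-2) R(γ', τ) γ' = 0`, the Euler-Lagrange equation of the
energy `(1/p) ∫ |τ|^p`. The equation is written in every chart of `M`. -/
def IsPBiharmonicCurve (p : ℝ) (g : SmoothRiemannianMetric n M) (γ : ℝ → M) (I : Set ℝ) : Prop :=
  ∀ φ ∈ IsManifold.maximalAtlas (𝓡 n) ∞ M, ∀ s ∈ I, γ s ∈ φ.source →
    coordTension g φ γ I s ≠ 0 ∧
    covDerivAlong g φ γ I
        (covDerivAlong g φ γ I
          (fun t => coordNorm g φ (φ (γ t)) (coordTension g φ γ I t) ^ (p - 2) •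
            coordTension g φ γ I t)) s
      - coordNorm g φ (φ (γ s)) (coordTension g φ γ I s) ^ (p - 2) •
          riemannApply g φ (φ (γ s)) (coordVelocity φ γ I s) (coordTension g φ γ I s)
            (coordVelocity φ γ I s) = 0

end Charts

section Surfaces

variable {M : Type u} [TopologicalSpace M] [ChartedSpace (EuclideanSpace ℝ (Fin 2)) M]
  [IsManifold (𝓡 2) ∞ M]

/-- The Gauss curvature `⟨R(∂₁, ∂₂) ∂₂, ∂₁⟩ / det (gᵢⱼ)` of the surface is constant, equal
to `K`. -/
def HasConstantGaussCurvature (g : SmoothRiemannianMetric 2 M) (K : ℝ) : Prop :=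
  ∀ φ ∈ IsManifold.maximalAtlas (𝓡 2) ∞ M, ∀ y ∈ φ.target,
    (∑ l, metricCoeff g φ y 0 l * riemannCoeff g φ l 0 1 1 y) / (metricCoeff g φ y).det = K

/-- `k` is the geodesic curvature of the arclength curve `γ` on the surface `M` with respect to
some choice of a smooth unit normal field `N` along `γ`: with `T = γ'` one has `∇_T T = k N`
(written in every chart). -/
def IsGeodesicCurvature (g : SmoothRiemannianMetric 2 M) (γ : ℝ → M) (I : Set ℝ) (k : ℝ → ℝ) :
    Prop :=
  ∃ N : (s : ℝ) → TangentSpace (𝓡 2) (γ s),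
    ContMDiffOn 𝓘(ℝ, ℝ) (𝓡 2).tangent ∞
      (fun s => (⟨γ s, N s⟩ : TangentBundle (𝓡 2) M)) I ∧
    (∀ s ∈ I, g.inner (γ s) (N s) (N s) = 1) ∧
    (∀ s ∈ I, g.inner (γ s) (velocity γ I s) (N s) = 0) ∧
    ∀ φ ∈ IsManifold.maximalAtlas (𝓡 2) ∞ M, ∀ s ∈ I, γ s ∈ φ.source → ∀ i : Fin 2,
      coordTension g φ γ I s i =
        k s * (show EuclideanSpace ℝ (Fin 2) from mfderiv (𝓡 2) (𝓡 2) φ (γ s) (N s)) i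

/-- `γ` is a proper `½`-biharmonic curve: a `½`-biharmonic curve of non-constant geodesic
curvature. -/
def IsProperHalfBiharmonicCurve (g : SmoothRiemannianMetric 2 M) (γ : ℝ → M) (I : Set ℝ) : Prop :=
  IsPBiharmonicCurve (1 / 2) g γ I ∧
    ∃ k : ℝ → ℝ, IsGeodesicCurvature g γ I k ∧ ∃ s ∈ I, ∃ t ∈ I, k s ≠ k t

end Surfaces

/-- `k` solves the curvature equation `¾ k'² - ½ k k'' - k⁴ + K k² = 0`. -/
def SolvesCurvatureODE (K : ℝ) (k : ℝ → ℝ) : Prop :=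
  ContDiff ℝ ∞ k ∧ ∀ s : ℝ,
    3 / 4 * deriv k s ^ 2 - 1 / 2 * k s * deriv (deriv k) s - k s ^ 4 + K * k s ^ 2 = 0

end

/-!
In a Frenet frame `(T, N)` one has `∇_T T = k N`, `∇_T N = -k T`, so with `r = |k|^(-3/2) k` the
tangential component of the Euler-Lagrange equation is `-(2 r' k + r k')`, which vanishes because
`r² |k|` is constant, and the normal component is a multiple of `¾ k'² - ½ k k'' - k⁴ + K k²`.
The substitution `k = a / D` turns this equation into the first integral
`½ D D'' - ¼ D'² + K D² = a²`, which has elementary solutions for `K = 0, 1, -1`; they are not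
constant on any interval because `D'` and `D''` have no common zero.

The curvatures of the plane and of the round sphere come from the Gauss equation: for an isometric
parametrization `X` the curvature tensor is the determinant of the second fundamental form, which is
`0` for the plane and `-gᵢⱼ X` for the sphere.
-/

noncomputable section

section PartialDerivatives

variable {n : ℕ} {F : Type*} [NormedAddCommGroup F] [NormedSpace ℝ F]

/-- The partial derivative `∂ᵢ X` of a vector-valued map; for real-valued maps it is
`partialDeriv`. -/
def vectorPartialDeriv (i : Fin n) (X : EuclideanSpace ℝ (Fin n) → F)
    (y : EuclideanSpace ℝ (Fin n)) : F :=
  fderiv ℝ X y (EuclideanSpace.single i 1)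

variable {X : EuclideanSpace ℝ (Fin n) → F} {f h : EuclideanSpace ℝ (Fin n) → ℝ}
  {U : Set (EuclideanSpace ℝ (Fin n))} {y : EuclideanSpace ℝ (Fin n)}

theorem fderiv_apply_eq_sum_vectorPartialDeriv (X : EuclideanSpace ℝ (Fin n) → F)
    (y v : EuclideanSpace ℝ (Fin n)) :
    fderiv ℝ X y v = ∑ i, v i • vectorPartialDeriv i X y := by
  conv_lhs => rw [← (EuclideanSpace.basisFun (Fin n) ℝ).sum_repr v]
  simp [vectorPartialDeriv]

theorem contDiffOn_vectorPartialDeriv (hX : ContDiffOn ℝ ∞ X U) (hU : IsOpen U) (i : Fin n) :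
    ContDiffOn ℝ ∞ (vectorPartialDeriv i X) U :=
  (hX.fderiv_of_isOpen hU (by simp)).clm_apply contDiffOn_const

theorem contDiffOn_partialDeriv (hf : ContDiffOn ℝ ∞ f U) (hU : IsOpen U) (i : Fin n) :
    ContDiffOn ℝ ∞ (partialDeriv i f) U :=
  contDiffOn_vectorPartialDeriv hf hU i

theorem vectorPartialDeriv_comm (hX : ContDiffAt ℝ 2 X y) (i j : Fin n) :
    vectorPartialDeriv i (vectorPartialDeriv j X) y =
      vectorPartialDeriv j (vectorPartialDeriv i X) y := by
  have hX' : DifferentiableAt ℝ (fderiv ℝ X) y :=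
    (hX.fderiv_right (m := 1) le_rfl).differentiableAt one_ne_zero
  have second_fderiv (i j : Fin n) : vectorPartialDeriv i (vectorPartialDeriv j X) y =
      fderiv ℝ (fderiv ℝ X) y (EuclideanSpace.single i 1) (EuclideanSpace.single j 1) := by
    change fderiv ℝ (fun z => fderiv ℝ X z (EuclideanSpace.single j 1)) y _ = _
    simp [fderiv_clm_apply hX' (differentiableAt_const _)]
  rw [second_fderiv, second_fderiv]
  exact (hX.isSymmSndFDerivAt (by simp)).eq _ _

theorem partialDeriv_comm (hf : ContDiffAt ℝ 2 f y) (i j : Fin n) :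
    partialDeriv i (partialDeriv j f) y = partialDeriv j (partialDeriv i f) y :=
  vectorPartialDeriv_comm hf i j

theorem partialDeriv_add (i : Fin n) (hf : DifferentiableAt ℝ f y) (hh : DifferentiableAt ℝ h y) :
    partialDeriv i (fun z => f z + h z) y = partialDeriv i f y + partialDeriv i h y := by
  simp [partialDeriv, fderiv_fun_add hf hh]

theorem partialDeriv_mul (i : Fin n) (hf : DifferentiableAt ℝ f y) (hh : DifferentiableAt ℝ h y) :
    partialDeriv i (fun z => f z * h z) y
      = partialDeriv i f y * h y + f y * partialDeriv i h y := by
  simp only [partialDeriv, fderiv_fun_mul hf hh, add_apply, smul_apply, smul_eq_mul]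
  ring

theorem partialDeriv_sum {ι : Type*} (i : Fin n) {s : Finset ι}
    {f : ι → EuclideanSpace ℝ (Fin n) → ℝ} (hf : ∀ l ∈ s, DifferentiableAt ℝ (f l) y) :
    partialDeriv i (fun z => ∑ l ∈ s, f l z) y = ∑ l ∈ s, partialDeriv i (f l) y := by
  simp [partialDeriv, fderiv_fun_sum hf]

theorem partialDeriv_congr (i : Fin n) (hfh : f =ᶠ[nhds y] h) :
    partialDeriv i f y = partialDeriv i h y := by
  rw [partialDeriv, partialDeriv, hfh.fderiv_eq]

end PartialDerivatives

section SmoothMatrices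

variable {E ι : Type*} [NormedAddCommGroup E] [NormedSpace ℝ E] [Fintype ι] [DecidableEq ι]
  {A : E → Matrix ι ι ℝ} {U : Set E} {m : WithTop ℕ∞}

theorem contDiffOn_matrix_det (hA : ∀ i j, ContDiffOn ℝ m (fun y => A y i j) U) :
    ContDiffOn ℝ m (fun y => (A y).det) U := by
  simp only [Matrix.det_apply]
  exact ContDiffOn.sum fun σ _ => (contDiffOn_prod fun i _ => hA (σ i) i).const_smul _

theorem contDiffOn_matrix_inv (hA : ∀ i j, ContDiffOn ℝ m (fun y => A y i j) U)
    (hdet : ∀ y ∈ U, (A y).det ≠ 0) (i j : ι) : ContDiffOn ℝ m (fun y => (A y)⁻¹ i j) U := by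
  simp only [Matrix.inv_def, Ring.inverse_eq_inv', Matrix.smul_apply, smul_eq_mul,
    Matrix.adjugate_apply]
  refine ((contDiffOn_matrix_det hA).inv hdet).mul (contDiffOn_matrix_det fun a b => ?_)
  obtain rfl | ha := eq_or_ne a j
  · simpa only [Matrix.updateRow_self] using contDiffOn_const
  · simpa only [Matrix.updateRow_ne ha] using hA a b

end SmoothMatrices

section Charts

variable {n : ℕ} {M : Type u} [TopologicalSpace M] [ChartedSpace (EuclideanSpace ℝ (Fin n)) M]
  {φ : OpenPartialHomeomorph M (EuclideanSpace ℝ (Fin n))}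

theorem mdifferentiable_of_mem_maximalAtlas (hφ : φ ∈ IsManifold.maximalAtlas (𝓡 n) ∞ M) :
    φ.MDifferentiable (𝓡 n) (𝓡 n) :=
  ⟨fun _ hx => ((contMDiffAt_of_mem_maximalAtlas hφ hx).mdifferentiableAt
      (by simp)).mdifferentiableWithinAt,
    fun _ hx => ((contMDiffAt_symm_of_mem_maximalAtlas hφ hx).mdifferentiableAt
      (by simp)).mdifferentiableWithinAt⟩

/-- The components in the chart `φ` of a tangent vector. -/
def tangentCoord (φ : OpenPartialHomeomorph M (EuclideanSpace ℝ (Fin n))) {x : M}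
    (v : TangentSpace (𝓡 n) x) : Fin n → ℝ :=
  (show EuclideanSpace ℝ (Fin n) from mfderiv (𝓡 n) (𝓡 n) φ x v).ofLp

variable [IsManifold (𝓡 n) ∞ M] (g : SmoothRiemannianMetric n M)

/-- The inner product of vectors given by their components in the chart `φ`. -/
def coordInner (φ : OpenPartialHomeomorph M (EuclideanSpace ℝ (Fin n)))
    (y : EuclideanSpace ℝ (Fin n)) : LinearMap.BilinForm ℝ (Fin n → ℝ) :=
  Matrix.toBilin' (metricCoeff g φ y)

theorem metricCoeff_comm (y : EuclideanSpace ℝ (Fin n)) (i j : Fin n) :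
    metricCoeff g φ y i j = metricCoeff g φ y j i :=
  g.symm _ _ _

theorem coordInner_comm (y : EuclideanSpace ℝ (Fin n)) (v w : Fin n → ℝ) :
    coordInner g φ y v w = coordInner g φ y w v := by
  rw [coordInner, Matrix.toBilin'_apply, Matrix.toBilin'_apply, Finset.sum_comm]
  refine Finset.sum_congr rfl fun i _ => Finset.sum_congr rfl fun j _ => ?_
  rw [metricCoeff_comm g y j i]
  ring

theorem inner_mfderiv_symm (y v w : EuclideanSpace ℝ (Fin n)) :
    g.inner (φ.symm y) (mfderiv (𝓡 n) (𝓡 n) φ.symm y v) (mfderiv (𝓡 n) (𝓡 n) φ.symm y w) =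
      coordInner g φ y v w := by
  have eq_sum (v : EuclideanSpace ℝ (Fin n)) : mfderiv (𝓡 n) (𝓡 n) φ.symm y v =
      ∑ i, v i • coordField φ y i := by
    conv_lhs => rw [← (EuclideanSpace.basisFun (Fin n) ℝ).sum_repr v]
    refine (map_sum _ _ _).trans (Finset.sum_congr rfl fun i _ => ?_)
    rw [EuclideanSpace.basisFun_repr, EuclideanSpace.basisFun_apply]
    exact map_smul _ (v i) _
  simp only [eq_sum, coordInner, Matrix.toBilin'_apply, map_sum, sum_apply, map_smul, smul_apply,
    smul_eq_mul, metricCoeff, Matrix.of_apply, Finset.mul_sum]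
  rw [Finset.sum_comm]
  refine Finset.sum_congr rfl fun i _ => Finset.sum_congr rfl fun j _ => ?_
  ring

theorem inner_eq_coordInner (hφ : φ ∈ IsManifold.maximalAtlas (𝓡 n) ∞ M) {x : M}
    (hx : x ∈ φ.source) (v w : TangentSpace (𝓡 n) x) :
    g.inner x v w = coordInner g φ (φ x) (tangentCoord φ v) (tangentCoord φ w) := by
  have symm_apply (v : TangentSpace (𝓡 n) x) :
      mfderiv (𝓡 n) (𝓡 n) φ.symm (φ x) (mfderiv (𝓡 n) (𝓡 n) φ x v) = v :=
    congrArg (fun L => L v) ((mdifferentiable_of_mem_maximalAtlas hφ).symm_comp_deriv hx)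
  refine Eq.trans ?_ (inner_mfderiv_symm (φ := φ) g (φ x) (mfderiv (𝓡 n) (𝓡 n) φ x v)
    (mfderiv (𝓡 n) (𝓡 n) φ x w))
  rw [symm_apply, symm_apply, φ.left_inv hx]

theorem posDef_metricCoeff (hφ : φ ∈ IsManifold.maximalAtlas (𝓡 n) ∞ M)
    {y : EuclideanSpace ℝ (Fin n)} (hy : y ∈ φ.target) : (metricCoeff g φ y).PosDef := by
  refine .of_dotProduct_mulVec_pos (Matrix.IsHermitian.ext fun i j => metricCoeff_comm g y j i)
    fun {v} hv => ?_
  have inner_pos : 0 < coordInner g φ y v v := by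
    rw [← inner_mfderiv_symm g y (WithLp.toLp 2 v)]
    refine g.pos _ _ fun hzero => hv ?_
    have apply_symm : mfderiv (𝓡 n) (𝓡 n) φ (φ.symm y)
        (mfderiv (𝓡 n) (𝓡 n) φ.symm y (WithLp.toLp 2 v)) = WithLp.toLp 2 v :=
      congrArg (fun L => L (WithLp.toLp 2 v))
        ((mdifferentiable_of_mem_maximalAtlas hφ).comp_symm_deriv hy)
    rw [hzero, map_zero] at apply_symm
    exact congrArg WithLp.ofLp apply_symm.symm
  simpa [coordInner, Matrix.toBilin'_apply'] using inner_pos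

theorem contMDiffOn_coordField (hφ : φ ∈ IsManifold.maximalAtlas (𝓡 n) ∞ M) (i : Fin n) :
    ContMDiffOn (𝓡 n) (𝓡 n).tangent ∞
      (fun y => (⟨φ.symm y, coordField φ y i⟩ : TangentBundle (𝓡 n) M)) φ.target := by
  have hsymm := (contMDiffOn_symm_of_mem_maximalAtlas hφ).contMDiffOn_tangentMapWithin (m := ∞)
    (by simp) φ.open_target.uniqueMDiffOn
  have hsingle : ContMDiff (𝓡 n) (𝓡 n).tangent ∞
      (fun y : EuclideanSpace ℝ (Fin n) =>
        (⟨y, (EuclideanSpace.single i (1 : ℝ) : EuclideanSpace ℝ (Fin n))⟩ :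
          TangentBundle (𝓡 n) (EuclideanSpace ℝ (Fin n)))) :=
    fun y => contMDiffAt_vectorSpace_iff_contDiffAt.2 contDiffAt_const
  refine (hsymm.comp (t := _) hsingle.contMDiffOn (s := φ.target) fun y hy => hy).congr
    fun y hy => ?_
  simp [tangentMapWithin, coordField, mfderivWithin_of_mem_nhds (φ.open_target.mem_nhds hy)]

theorem contDiffOn_metricCoeff (hφ : φ ∈ IsManifold.maximalAtlas (𝓡 n) ∞ M) (i j : Fin n) :
    ContDiffOn ℝ ∞ (fun y => metricCoeff g φ y i j) φ.target := by
  rw [← contMDiffOn_iff_contDiffOn]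
  intro y hy
  have : ContMDiffWithinAt (𝓡 n) ((𝓡 n).prod 𝓘(ℝ)) ∞
      (fun y ↦ Bundle.TotalSpace.mk' ℝ (E := Bundle.Trivial M ℝ) (φ.symm y)
        (g.inner (φ.symm y) (coordField φ y i) (coordField φ y j))) φ.target y :=
    ContMDiffWithinAt.clm_bundle_apply₂ (F₁ := EuclideanSpace ℝ (Fin n))
      (F₂ := EuclideanSpace ℝ (Fin n))
      (g.contMDiff.contMDiffAt.comp_contMDiffWithinAt y
        (contMDiffOn_symm_of_mem_maximalAtlas hφ y hy))
      (contMDiffOn_coordField hφ i y hy) (contMDiffOn_coordField hφ j y hy)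
  simp only [Bundle.contMDiffWithinAt_totalSpace] at this
  exact this.2

theorem contDiffOn_christoffel (hφ : φ ∈ IsManifold.maximalAtlas (𝓡 n) ∞ M) (k i j : Fin n) :
    ContDiffOn ℝ ∞ (christoffel g φ k i j) φ.target := by
  have hG (i j l : Fin n) :=
    contDiffOn_partialDeriv (contDiffOn_metricCoeff g hφ i j) φ.open_target l
  have hinv (l : Fin n) := contDiffOn_matrix_inv (contDiffOn_metricCoeff g hφ)
    (fun y hy => (posDef_metricCoeff g hφ hy).det_pos.ne') k l
  unfold christoffel
  exact contDiffOn_const.mul (ContDiffOn.sum fun l _ =>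
    (hinv l).mul (((hG _ _ _).add (hG _ _ _)).sub (hG _ _ _)))

end Charts

section LeviCivita

variable {n : ℕ} {M : Type u} [TopologicalSpace M] [ChartedSpace (EuclideanSpace ℝ (Fin n)) M]
  [IsManifold (𝓡 n) ∞ M] (g : SmoothRiemannianMetric n M)
  {φ : OpenPartialHomeomorph M (EuclideanSpace ℝ (Fin n))} {y : EuclideanSpace ℝ (Fin n)}

/-- The Christoffel symbols of the first kind, `Γ_{a,ij} = ⟨∇_{∂ᵢ} ∂ⱼ, ∂ₐ⟩`. -/
def christoffelFirst (φ : OpenPartialHomeomorph M (EuclideanSpace ℝ (Fin n))) (a i j : Fin n)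
    (y : EuclideanSpace ℝ (Fin n)) : ℝ :=
  1 / 2 * (partialDeriv i (fun z => metricCoeff g φ z j a) y
    + partialDeriv j (fun z => metricCoeff g φ z i a) y
    - partialDeriv a (fun z => metricCoeff g φ z i j) y)

theorem christoffel_eq_sum_inv_mul_christoffelFirst (k i j : Fin n) :
    christoffel g φ k i j y =
      ∑ a, (metricCoeff g φ y)⁻¹ k a * christoffelFirst g φ a i j y := by
  rw [christoffel, Finset.mul_sum]
  refine Finset.sum_congr rfl fun a _ => ?_
  rw [christoffelFirst]
  ring

theorem sum_metricCoeff_mul_christoffel (hφ : φ ∈ IsManifold.maximalAtlas (𝓡 n) ∞ M)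
    (hy : y ∈ φ.target) (a i j : Fin n) :
    ∑ l, metricCoeff g φ y a l * christoffel g φ l i j y = christoffelFirst g φ a i j y := by
  have hinv : metricCoeff g φ y * (metricCoeff g φ y)⁻¹ = 1 :=
    Matrix.mul_nonsing_inv _ (posDef_metricCoeff g hφ hy).det_pos.ne'.isUnit
  simp only [christoffel_eq_sum_inv_mul_christoffelFirst]
  change (metricCoeff g φ y).mulVec ((metricCoeff g φ y)⁻¹.mulVec
    fun a => christoffelFirst g φ a i j y) a = _
  rw [Matrix.mulVec_mulVec, hinv, Matrix.one_mulVec]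

theorem partialDeriv_metricCoeff (m i j : Fin n) :
    partialDeriv m (fun z => metricCoeff g φ z i j) y =
      christoffelFirst g φ i m j y + christoffelFirst g φ j m i y := by
  simp only [christoffelFirst, metricCoeff_comm g _ j i]
  ring

theorem sum_christoffelFirst_mul_christoffel_comm
    (hφ : φ ∈ IsManifold.maximalAtlas (𝓡 n) ∞ M) (hy : y ∈ φ.target) (a b c d : Fin n) :
    ∑ l, christoffelFirst g φ l a b y * christoffel g φ l c d y =
      ∑ l, christoffelFirst g φ l c d y * christoffel g φ l a b y := by
  simp only [← sum_metricCoeff_mul_christoffel g hφ hy, Finset.sum_mul]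
  rw [Finset.sum_comm]
  refine Finset.sum_congr rfl fun i _ => Finset.sum_congr rfl fun j _ => ?_
  rw [metricCoeff_comm g y j i]
  ring

theorem differentiableAt_metricCoeff (hφ : φ ∈ IsManifold.maximalAtlas (𝓡 n) ∞ M)
    (hy : y ∈ φ.target) (i j : Fin n) :
    DifferentiableAt ℝ (fun z => metricCoeff g φ z i j) y :=
  ((contDiffOn_metricCoeff g hφ i j).contDiffAt (φ.open_target.mem_nhds hy)).differentiableAt
    (by simp)

theorem differentiableAt_christoffel (hφ : φ ∈ IsManifold.maximalAtlas (𝓡 n) ∞ M)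
    (hy : y ∈ φ.target) (k i j : Fin n) : DifferentiableAt ℝ (christoffel g φ k i j) y :=
  ((contDiffOn_christoffel g hφ k i j).contDiffAt (φ.open_target.mem_nhds hy)).differentiableAt
    (by simp)

theorem differentiableAt_christoffelFirst (hφ : φ ∈ IsManifold.maximalAtlas (𝓡 n) ∞ M)
    (hy : y ∈ φ.target) (a i j : Fin n) :
    DifferentiableAt ℝ (christoffelFirst g φ a i j) y := by
  have hG (i j l : Fin n) := ((contDiffOn_partialDeriv (contDiffOn_metricCoeff g hφ i j)
    φ.open_target l).contDiffAt (φ.open_target.mem_nhds hy)).differentiableAt (by simp)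
  exact (((hG _ _ _).add (hG _ _ _)).sub (hG _ _ _)).const_mul _

theorem partialDeriv_christoffelFirst (hφ : φ ∈ IsManifold.maximalAtlas (𝓡 n) ∞ M)
    (hy : y ∈ φ.target) (i a j k : Fin n) :
    partialDeriv i (christoffelFirst g φ a j k) y =
      ∑ l, (partialDeriv i (fun z => metricCoeff g φ z a l) y * christoffel g φ l j k y +
        metricCoeff g φ y a l * partialDeriv i (christoffel g φ l j k) y) := by
  have lower_index : christoffelFirst g φ a j k =ᶠ[nhds y] fun z =>
      ∑ l, metricCoeff g φ z a l * christoffel g φ l j k z := by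
    filter_upwards [φ.open_target.mem_nhds hy] with z hz
    exact (sum_metricCoeff_mul_christoffel g hφ hz a j k).symm
  have hG (l : Fin n) := differentiableAt_metricCoeff g hφ hy a l
  have hΓ (l : Fin n) := differentiableAt_christoffel g hφ hy l j k
  rw [partialDeriv_congr i lower_index, partialDeriv_sum i fun l _ => (hG l).fun_mul (hΓ l)]
  exact Finset.sum_congr rfl fun l _ => partialDeriv_mul i (hG l) (hΓ l)

/-- The components `Rₐᵢⱼₖ = ⟨R(∂ᵢ, ∂ⱼ) ∂ₖ, ∂ₐ⟩` of the curvature tensor with lowered index. -/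
def riemannLower (φ : OpenPartialHomeomorph M (EuclideanSpace ℝ (Fin n))) (a i j k : Fin n)
    (y : EuclideanSpace ℝ (Fin n)) : ℝ :=
  ∑ l, metricCoeff g φ y a l * riemannCoeff g φ l i j k y

theorem riemannLower_eq (hφ : φ ∈ IsManifold.maximalAtlas (𝓡 n) ∞ M) (hy : y ∈ φ.target)
    (a i j k : Fin n) :
    riemannLower g φ a i j k y =
      partialDeriv i (christoffelFirst g φ a j k) y - partialDeriv j (christoffelFirst g φ a i k) y
        - ∑ l, (christoffelFirst g φ l i a y * christoffel g φ l j k y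
          - christoffelFirst g φ l j a y * christoffel g φ l i k y) := by
  have lower_product (i j k : Fin n) :
      ∑ l, metricCoeff g φ y a l * ∑ m, christoffel g φ l i m y * christoffel g φ m j k y =
        ∑ m, christoffelFirst g φ a i m y * christoffel g φ m j k y := by
    simp only [← sum_metricCoeff_mul_christoffel g hφ hy, Finset.mul_sum, Finset.sum_mul]
    rw [Finset.sum_comm]
    exact Finset.sum_congr rfl fun i _ => Finset.sum_congr rfl fun j _ => (mul_assoc _ _ _).symm
  simp only [riemannLower, riemannCoeff, mul_add, mul_sub, Finset.sum_add_distrib,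
    Finset.sum_sub_distrib, lower_product, partialDeriv_christoffelFirst g hφ hy,
    partialDeriv_metricCoeff, add_mul]
  ring

theorem riemannLower_swap (a i j k : Fin n) :
    riemannLower g φ a j i k y = -riemannLower g φ a i j k y := by
  simp only [riemannLower, riemannCoeff, ← Finset.sum_neg_distrib]
  refine Finset.sum_congr rfl fun l _ => ?_
  rw [← mul_neg]
  simp only [Finset.sum_sub_distrib]
  ring

theorem riemannLower_skew (hφ : φ ∈ IsManifold.maximalAtlas (𝓡 n) ∞ M) (hy : y ∈ φ.target)
    (a i j k : Fin n) : riemannLower g φ k i j a y = -riemannLower g φ a i j k y := by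
  have second_derivative (i j : Fin n) :
      partialDeriv i (partialDeriv j (fun z => metricCoeff g φ z a k)) y =
        partialDeriv i (christoffelFirst g φ a j k) y +
          partialDeriv i (christoffelFirst g φ k j a) y := by
    refine (partialDeriv_congr i (.of_forall fun z => partialDeriv_metricCoeff g j a k)).trans ?_
    exact partialDeriv_add i (differentiableAt_christoffelFirst g hφ hy a j k)
      (differentiableAt_christoffelFirst g hφ hy k j a)
  have hcomm := partialDeriv_comm (((contDiffOn_metricCoeff g hφ a k).contDiffAt
    (φ.open_target.mem_nhds hy)).of_le (by norm_cast)) i j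
  rw [second_derivative, second_derivative] at hcomm
  rw [riemannLower_eq g hφ hy, riemannLower_eq g hφ hy, Finset.sum_sub_distrib,
    Finset.sum_sub_distrib, sum_christoffelFirst_mul_christoffel_comm g hφ hy i k,
    sum_christoffelFirst_mul_christoffel_comm g hφ hy j k]
  linear_combination hcomm

end LeviCivita

section GaussCurvature

variable {M : Type u} [TopologicalSpace M] [ChartedSpace (EuclideanSpace ℝ (Fin 2)) M]
  [IsManifold (𝓡 2) ∞ M] (g : SmoothRiemannianMetric 2 M)
  {φ : OpenPartialHomeomorph M (EuclideanSpace ℝ (Fin 2))} {y : EuclideanSpace ℝ (Fin 2)}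

/-- The Gauss curvature `⟨R(∂₁, ∂₂) ∂₂, ∂₁⟩ / det (gᵢⱼ)` at the point with coordinates `y`. -/
def gaussCurvature (φ : OpenPartialHomeomorph M (EuclideanSpace ℝ (Fin 2)))
    (y : EuclideanSpace ℝ (Fin 2)) : ℝ :=
  riemannLower g φ 0 0 1 1 y / (metricCoeff g φ y).det

theorem riemannLower_eq_gaussCurvature_mul (hφ : φ ∈ IsManifold.maximalAtlas (𝓡 2) ∞ M)
    (hy : y ∈ φ.target) (a i j k : Fin 2) :
    riemannLower g φ a i j k y = gaussCurvature g φ y *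
      (metricCoeff g φ y j k * metricCoeff g φ y i a
        - metricCoeff g φ y i k * metricCoeff g φ y j a) := by
  have hdet : riemannLower g φ 0 0 1 1 y = gaussCurvature g φ y *
      (metricCoeff g φ y 0 0 * metricCoeff g φ y 1 1
        - metricCoeff g φ y 0 1 * metricCoeff g φ y 1 0) := by
    rw [← Matrix.det_fin_two, gaussCurvature,
      div_mul_cancel₀ _ (posDef_metricCoeff g hφ hy).det_pos.ne']
  have diag_ij (a i k : Fin 2) : riemannLower g φ a i i k y = 0 := by
    linarith [riemannLower_swap g (φ := φ) (y := y) a i i k]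
  have diag_ak (a i j : Fin 2) : riemannLower g φ a i j a y = 0 := by
    linarith [riemannLower_skew g hφ hy a i j a]
  have swap := riemannLower_swap g (φ := φ) (y := y) (i := 0) (j := 1)
  have skew := riemannLower_skew g hφ hy (a := 0) (k := 1)
  fin_cases a <;> fin_cases i <;> fin_cases j <;> fin_cases k <;>
    simp only [Fin.zero_eta, Fin.mk_one, diag_ij, diag_ak, swap, skew, hdet,
      metricCoeff_comm g y 1 0] <;> ring

theorem riemannCoeff_eq_gaussCurvature_mul (hφ : φ ∈ IsManifold.maximalAtlas (𝓡 2) ∞ M)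
    (hy : y ∈ φ.target) (l i j k : Fin 2) :
    riemannCoeff g φ l i j k y = gaussCurvature g φ y *
      (metricCoeff g φ y j k * (1 : Matrix (Fin 2) (Fin 2) ℝ) i l
        - metricCoeff g φ y i k * (1 : Matrix (Fin 2) (Fin 2) ℝ) j l) := by
  refine congrFun (Matrix.mulVec_injective_of_isUnit
    ((Matrix.isUnit_iff_isUnit_det _).2 (posDef_metricCoeff g hφ hy).det_pos.ne'.isUnit)
    (a₁ := fun l => riemannCoeff g φ l i j k y) (a₂ := fun l => gaussCurvature g φ y *
      (metricCoeff g φ y j k * (1 : Matrix (Fin 2) (Fin 2) ℝ) i l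
        - metricCoeff g φ y i k * (1 : Matrix (Fin 2) (Fin 2) ℝ) j l)) ?_) l
  ext a
  refine (riemannLower_eq_gaussCurvature_mul g hφ hy a i j k).trans ?_
  simp only [Matrix.mulVec, dotProduct, Matrix.one_apply, metricCoeff_comm g y _ a]
  simp only [mul_sub, mul_ite, mul_one, mul_zero, Finset.sum_sub_distrib, Finset.sum_ite_eq,
    Finset.mem_univ, if_true]
  ring

theorem riemannApply_eq_gaussCurvature_smul (hφ : φ ∈ IsManifold.maximalAtlas (𝓡 2) ∞ M)
    (hy : y ∈ φ.target) (X Y Z : Fin 2 → ℝ) :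
    riemannApply g φ y X Y Z = gaussCurvature g φ y •
      (coordInner g φ y Y Z • X - coordInner g φ y X Z • Y) := by
  ext l
  simp only [riemannApply, riemannCoeff_eq_gaussCurvature_mul g hφ hy, coordInner,
    Matrix.toBilin'_apply, Fin.sum_univ_two, Pi.smul_apply, Pi.sub_apply, smul_eq_mul]
  fin_cases l <;> simp [Matrix.one_apply] <;> ring

theorem hasConstantGaussCurvature_iff {K : ℝ} :
    HasConstantGaussCurvature g K ↔ ∀ φ ∈ IsManifold.maximalAtlas (𝓡 2) ∞ M, ∀ y ∈ φ.target,
      gaussCurvature g φ y = K :=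
  Iff.rfl

end GaussCurvature

theorem eq_sum_smul_of_orthonormal {𝕜 V ι : Type*} [Field 𝕜] [AddCommGroup V] [Module 𝕜 V]
    [FiniteDimensional 𝕜 V] [Fintype ι] [DecidableEq ι] {B : LinearMap.BilinForm 𝕜 V} {e : ι → V}
    (he : ∀ i j, B (e i) (e j) = if i = j then 1 else 0)
    (hcard : Fintype.card ι = Module.finrank 𝕜 V) (v : V) : v = ∑ i, B v (e i) • e i := by
  have hlin : LinearIndependent 𝕜 e :=
    LinearMap.linearIndependent_of_isOrthoᵢ (B := B)
      (LinearMap.isOrthoᵢ_def.2 fun i j hij => by rw [he, if_neg hij])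
      fun i => by rw [he, if_pos rfl]; exact one_ne_zero
  obtain ⟨c, rfl⟩ : ∃ c : ι → 𝕜, ∑ i, c i • e i = v := by
    rw [← Submodule.mem_span_range_iff_exists_fun, hlin.span_eq_top_of_card_eq_finrank' hcard]
    exact Submodule.mem_top
  simp [he]

theorem uniqueDiffOn_of_ordConnected_of_nontrivial {I : Set ℝ} (hI : I.OrdConnected)
    (hI' : I.Nontrivial) : UniqueDiffOn ℝ I := by
  obtain ⟨a, ha, b, hb, hab⟩ := hI'.exists_lt
  refine uniqueDiffOn_convex hI.convex ((Set.nonempty_Ioo.2 hab).mono ?_)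
  rw [← interior_Icc]
  exact interior_mono (hI.out ha hb)

section Curves

variable {n : ℕ} {M : Type u} [TopologicalSpace M]
  {φ : OpenPartialHomeomorph M (EuclideanSpace ℝ (Fin n))} {γ : ℝ → M} {I : Set ℝ} {s : ℝ}

theorem eventually_mem_and_mem_chart_source (hγ : ContinuousWithinAt γ I s)
    (hγs : γ s ∈ φ.source) : ∀ᶠ t in nhdsWithin s I, t ∈ I ∧ γ t ∈ φ.source :=
  eventually_mem_nhdsWithin.and (hγ (φ.open_source.mem_nhds hγs))

variable [ChartedSpace (EuclideanSpace ℝ (Fin n)) M]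

theorem contDiffWithinAt_chart (hφ : φ ∈ IsManifold.maximalAtlas (𝓡 n) ∞ M)
    (hγ : ContMDiffWithinAt 𝓘(ℝ, ℝ) (𝓡 n) ∞ γ I s) (hγs : γ s ∈ φ.source) :
    ContDiffWithinAt ℝ ∞ (fun t => φ (γ t)) I s := by
  rw [← contMDiffWithinAt_iff_contDiffWithinAt]
  exact (contMDiffAt_of_mem_maximalAtlas hφ hγs).comp_contMDiffWithinAt s hγ

theorem contDiffWithinAt_coordVelocity (hφ : φ ∈ IsManifold.maximalAtlas (𝓡 n) ∞ M)
    (hI : UniqueDiffOn ℝ I) (hs : s ∈ I) (hγ : ContMDiffWithinAt 𝓘(ℝ, ℝ) (𝓡 n) ∞ γ I s)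
    (hγs : γ s ∈ φ.source) : ContDiffWithinAt ℝ ∞ (coordVelocity φ γ I) I s :=
  contDiffWithinAt_pi.2 fun i =>
    ((contDiffWithinAt_euclidean.1 (contDiffWithinAt_chart hφ hγ hγs) i).fderivWithin_right
      (m := ∞) hI (by simp) hs).clm_apply contDiffWithinAt_const

theorem hasDerivWithinAt_chart (hφ : φ ∈ IsManifold.maximalAtlas (𝓡 n) ∞ M)
    (hγ : ContMDiffWithinAt 𝓘(ℝ, ℝ) (𝓡 n) ∞ γ I s) (hγs : γ s ∈ φ.source) :
    HasDerivWithinAt (fun t => φ (γ t)) (WithLp.toLp 2 (coordVelocity φ γ I s)) I s := by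
  have hdiff := (contDiffWithinAt_chart hφ hγ hγs).differentiableWithinAt (by simp)
  refine hasDerivWithinAt_iff_hasFDerivWithinAt.2 (hasFDerivWithinAt_euclidean.2 fun i => ?_)
  refine ((differentiableWithinAt_euclidean.1 hdiff i).hasDerivWithinAt).hasFDerivWithinAt
    |>.congr_fderiv ?_
  ext
  simp [coordVelocity]

theorem coordVelocity_eq_tangentCoord (hφ : φ ∈ IsManifold.maximalAtlas (𝓡 n) ∞ M)
    (hI : UniqueDiffWithinAt ℝ I s) (hγ : ContMDiffWithinAt 𝓘(ℝ, ℝ) (𝓡 n) ∞ γ I s)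
    (hγs : γ s ∈ φ.source) :
    coordVelocity φ γ I s = tangentCoord φ (velocity γ I s) := by
  have hchain : HasMFDerivWithinAt 𝓘(ℝ, ℝ) (𝓡 n) (φ ∘ γ) I s _ :=
    ((contMDiffAt_of_mem_maximalAtlas hφ hγs).mdifferentiableAt
      (by simp)).hasMFDerivAt.comp_hasMFDerivWithinAt s
      (hγ.mdifferentiableWithinAt (by simp)).hasMFDerivWithinAt
  have hderiv : HasFDerivWithinAt (φ ∘ γ) (_ : ℝ →L[ℝ] EuclideanSpace ℝ (Fin n)) I s :=
    hasMFDerivWithinAt_iff_hasFDerivWithinAt.1 hchain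
  exact congrArg WithLp.ofLp (((hasDerivWithinAt_chart hφ hγ hγs).derivWithin hI).symm.trans
    (hderiv.hasDerivWithinAt.derivWithin hI))

variable [IsManifold (𝓡 n) ∞ M]

theorem contDiffWithinAt_tangentCoord (hφ : φ ∈ IsManifold.maximalAtlas (𝓡 n) ∞ M)
    {N : (t : ℝ) → TangentSpace (𝓡 n) (γ t)}
    (hN : ContMDiffWithinAt 𝓘(ℝ, ℝ) (𝓡 n).tangent ∞
      (fun t => (⟨γ t, N t⟩ : TangentBundle (𝓡 n) M)) I s) (hγs : γ s ∈ φ.source) :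
    ContDiffWithinAt ℝ ∞ (fun t => tangentCoord φ (N t)) I s := by
  have htangentMap := ((contMDiffOn_of_mem_maximalAtlas hφ).contMDiffOn_tangentMapWithin (m := ∞)
    (by simp) φ.open_source.uniqueMDiffOn).contMDiffAt (x := ⟨γ s, N s⟩)
    ((φ.open_source.preimage (FiberBundle.continuous_proj _ _)).mem_nhds hγs)
  have hsnd := ((contMDiff_snd_tangentBundle_modelSpace (n := ∞) (EuclideanSpace ℝ (Fin n))
    (𝓡 n)).contMDiffAt.comp_contMDiffWithinAt s
      (htangentMap.comp_contMDiffWithinAt s hN)).contDiffWithinAt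
  have hcont : ContinuousWithinAt γ I s :=
    (FiberBundle.continuous_proj _ _).continuousAt.comp_continuousWithinAt hN.continuousWithinAt
  have htangentCoord {t : ℝ} (ht : γ t ∈ φ.source) : tangentCoord φ (N t) =
      (tangentMapWithin (𝓡 n) (𝓡 n) φ φ.source ⟨γ t, N t⟩).snd.ofLp :=
    congrArg (fun L : EuclideanSpace ℝ (Fin n) →L[ℝ] EuclideanSpace ℝ (Fin n) => (L (N t)).ofLp)
      (mfderivWithin_of_mem_nhds (φ.open_source.mem_nhds ht)).symm
  refine contDiffWithinAt_pi.2 fun i => (contDiffWithinAt_euclidean.1 hsnd i).congr_of_eventuallyEq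
    ?_ (congrFun (htangentCoord hγs) i)
  filter_upwards [hcont (φ.open_source.mem_nhds hγs)] with t ht
  exact congrFun (htangentCoord ht) i

variable {g : SmoothRiemannianMetric n M} {V W : ℝ → Fin n → ℝ}

theorem covDerivAlong_congr (h : V =ᶠ[nhdsWithin s I] W) (hs : s ∈ I) :
    covDerivAlong g φ γ I V s = covDerivAlong g φ γ I W s := by
  have hVW : V s = W s := h.self_of_nhdsWithin hs
  have hderiv (k : Fin n) : derivWithin (fun t => V t k) I s = derivWithin (fun t => W t k) I s :=
    (h.fun_comp (· k)).derivWithin_eq (congrFun hVW k)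
  ext k
  simp only [covDerivAlong, hderiv, hVW]

theorem covDerivAlong_eventuallyEq (h : V =ᶠ[nhdsWithin s I] W) :
    covDerivAlong g φ γ I V =ᶠ[nhdsWithin s I] covDerivAlong g φ γ I W :=
  ((eventually_eventually_nhdsWithin.2 h).and eventually_mem_nhdsWithin).mono fun _ ht =>
    covDerivAlong_congr ht.1 ht.2

theorem covDerivAlong_add (hV : DifferentiableWithinAt ℝ V I s)
    (hW : DifferentiableWithinAt ℝ W I s) :
    covDerivAlong g φ γ I (fun t => V t + W t) s =
      covDerivAlong g φ γ I V s + covDerivAlong g φ γ I W s := by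
  ext k
  simp only [covDerivAlong, Pi.add_apply, derivWithin_fun_add (differentiableWithinAt_pi.1 hV k)
    (differentiableWithinAt_pi.1 hW k), mul_add, Finset.sum_add_distrib]
  ring

theorem covDerivAlong_smul {r : ℝ → ℝ} {r' : ℝ} (hI : UniqueDiffWithinAt ℝ I s)
    (hr : HasDerivWithinAt r r' I s) (hV : DifferentiableWithinAt ℝ V I s) :
    covDerivAlong g φ γ I (fun t => r t • V t) s =
      r' • V s + r s • covDerivAlong g φ γ I V s := by
  ext k
  simp only [covDerivAlong, Pi.add_apply, Pi.smul_apply, smul_eq_mul,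
    derivWithin_fun_mul hr.differentiableWithinAt (differentiableWithinAt_pi.1 hV k),
    hr.derivWithin hI, mul_add, Finset.mul_sum, mul_left_comm (r s), add_assoc]

theorem hasDerivWithinAt_metricCoeff (hφ : φ ∈ IsManifold.maximalAtlas (𝓡 n) ∞ M)
    (hγ : ContMDiffWithinAt 𝓘(ℝ, ℝ) (𝓡 n) ∞ γ I s) (hγs : γ s ∈ φ.source) (i j : Fin n) :
    HasDerivWithinAt (fun t => metricCoeff g φ (φ (γ t)) i j)
      (∑ m, coordVelocity φ γ I s m * (christoffelFirst g φ i m j (φ (γ s)) +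
        christoffelFirst g φ j m i (φ (γ s)))) I s := by
  have hderiv := (differentiableAt_metricCoeff g hφ (φ.map_source hγs) i
    j).hasFDerivAt.comp_hasDerivWithinAt s (hasDerivWithinAt_chart hφ hγ hγs)
  rw [fderiv_apply_eq_sum_vectorPartialDeriv] at hderiv
  simp only [← partialDeriv_metricCoeff]
  exact hderiv

theorem coordInner_covDerivAlong (hφ : φ ∈ IsManifold.maximalAtlas (𝓡 n) ∞ M)
    (hγs : γ s ∈ φ.source) (Y : Fin n → ℝ) :
    coordInner g φ (φ (γ s)) Y (covDerivAlong g φ γ I V s) =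
      ∑ a, ∑ j, Y a * (metricCoeff g φ (φ (γ s)) a j * derivWithin (fun t => V t j) I s +
        (∑ i, coordVelocity φ γ I s i * christoffelFirst g φ a i j (φ (γ s))) * V s j) := by
  simp only [coordInner, Matrix.toBilin'_apply, covDerivAlong,
    ← sum_metricCoeff_mul_christoffel g hφ (φ.map_source hγs), mul_add, Finset.mul_sum,
    Finset.sum_mul, Finset.sum_add_distrib]
  congr 1
  · exact Finset.sum_congr rfl fun a _ => Finset.sum_congr rfl fun l _ => mul_assoc _ _ _
  · refine Finset.sum_congr rfl fun a _ => ?_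
    rw [Finset.sum_comm_cycle]
    refine Finset.sum_congr rfl fun j _ => ?_
    rw [Finset.sum_comm]
    refine Finset.sum_congr rfl fun i _ => Finset.sum_congr rfl fun l _ => ?_
    ring

theorem hasDerivWithinAt_coordInner (hφ : φ ∈ IsManifold.maximalAtlas (𝓡 n) ∞ M)
    (hγ : ContMDiffWithinAt 𝓘(ℝ, ℝ) (𝓡 n) ∞ γ I s) (hγs : γ s ∈ φ.source)
    (hV : DifferentiableWithinAt ℝ V I s) (hW : DifferentiableWithinAt ℝ W I s) :
    HasDerivWithinAt (fun t => coordInner g φ (φ (γ t)) (V t) (W t))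
      (coordInner g φ (φ (γ s)) (covDerivAlong g φ γ I V s) (W s) +
        coordInner g φ (φ (γ s)) (V s) (covDerivAlong g φ γ I W s)) I s := by
  have hproduct : HasDerivWithinAt (fun t => ∑ i, ∑ j, V t i * metricCoeff g φ (φ (γ t)) i j *
      W t j) _ I s :=
    HasDerivWithinAt.fun_sum (u := Finset.univ) fun i _ =>
      HasDerivWithinAt.fun_sum (u := Finset.univ) fun j _ =>
        ((differentiableWithinAt_pi.1 hV i).hasDerivWithinAt.fun_mul
          (hasDerivWithinAt_metricCoeff (g := g) hφ hγ hγs i j)).fun_mul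
          (differentiableWithinAt_pi.1 hW j).hasDerivWithinAt
  rw [coordInner_comm _ _ (covDerivAlong g φ γ I V s), coordInner_covDerivAlong hφ hγs,
    coordInner_covDerivAlong hφ hγs, Finset.sum_comm]
  simp only [← Finset.sum_add_distrib, coordInner, Matrix.toBilin'_apply]
  refine hproduct.congr_deriv (Finset.sum_congr rfl fun i _ => Finset.sum_congr rfl fun j _ => ?_)
  simp only [mul_add, Finset.sum_add_distrib, metricCoeff_comm g _ j i]
  ring

end Curves

section UnitNormals

variable {n : ℕ} {M : Type u} [TopologicalSpace M] [ChartedSpace (EuclideanSpace ℝ (Fin n)) M]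
  [IsManifold (𝓡 n) ∞ M] {g : SmoothRiemannianMetric n M}
  {φ : OpenPartialHomeomorph M (EuclideanSpace ℝ (Fin n))} {γ : ℝ → M} {I : Set ℝ} {s : ℝ}

theorem coordNorm_eq_sqrt_coordInner (y : EuclideanSpace ℝ (Fin n)) (V : Fin n → ℝ) :
    coordNorm g φ y V = √(coordInner g φ y V V) := by
  simp only [coordNorm, coordInner, Matrix.toBilin'_apply, mul_comm (metricCoeff g φ y _ _)]

theorem coordNorm_smul_of_coordInner_self_eq_one {y : EuclideanSpace ℝ (Fin n)} {V : Fin n → ℝ}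
    (hV : coordInner g φ y V V = 1) (c : ℝ) : coordNorm g φ y (c • V) = |c| := by
  rw [coordNorm_eq_sqrt_coordInner, LinearMap.map_smul₂, map_smul, hV, smul_eq_mul,
    smul_eq_mul, mul_one, Real.sqrt_mul_self_eq_abs]

theorem IsArclengthCurve.uniqueDiffOn (hγ : IsArclengthCurve g γ I) : UniqueDiffOn ℝ I :=
  uniqueDiffOn_of_ordConnected_of_nontrivial hγ.ordConnected hγ.nontrivial

theorem IsArclengthCurve.coordInner_coordVelocity_self (hγ : IsArclengthCurve g γ I)
    (hφ : φ ∈ IsManifold.maximalAtlas (𝓡 n) ∞ M) (hs : s ∈ I) (hγs : γ s ∈ φ.source) :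
    coordInner g φ (φ (γ s)) (coordVelocity φ γ I s) (coordVelocity φ γ I s) = 1 := by
  rw [coordVelocity_eq_tangentCoord hφ (hγ.uniqueDiffOn s hs) (hγ.smooth s hs) hγs,
    ← inner_eq_coordInner g hφ hγs, hγ.unit_speed s hs]

theorem coordInner_covDerivAlong_add_of_eventuallyEq_const
    (hφ : φ ∈ IsManifold.maximalAtlas (𝓡 n) ∞ M) (hI : UniqueDiffWithinAt ℝ I s) (hs : s ∈ I)
    (hγ : ContMDiffWithinAt 𝓘(ℝ, ℝ) (𝓡 n) ∞ γ I s) (hγs : γ s ∈ φ.source)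
    {V W : ℝ → Fin n → ℝ} (hV : DifferentiableWithinAt ℝ V I s)
    (hW : DifferentiableWithinAt ℝ W I s) {c : ℝ}
    (hc : (fun t => coordInner g φ (φ (γ t)) (V t) (W t)) =ᶠ[nhdsWithin s I] fun _ => c) :
    coordInner g φ (φ (γ s)) (covDerivAlong g φ γ I V s) (W s) +
      coordInner g φ (φ (γ s)) (V s) (covDerivAlong g φ γ I W s) = 0 := by
  rw [← (hasDerivWithinAt_coordInner hφ hγ hγs hV hW).derivWithin hI,
    hc.derivWithin_eq (hc.self_of_nhdsWithin hs), derivWithin_fun_const]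
  rfl

/-- `N` is a smooth unit normal field along the curve `γ`, the field `N` with respect to which the
geodesic curvature is measured. -/
structure IsUnitNormalField (g : SmoothRiemannianMetric n M) (γ : ℝ → M) (I : Set ℝ)
    (N : (s : ℝ) → TangentSpace (𝓡 n) (γ s)) : Prop where
  smooth : ContMDiffOn 𝓘(ℝ, ℝ) (𝓡 n).tangent ∞
    (fun s => (⟨γ s, N s⟩ : TangentBundle (𝓡 n) M)) I
  inner_self : ∀ s ∈ I, g.inner (γ s) (N s) (N s) = 1
  inner_velocity : ∀ s ∈ I, g.inner (γ s) (velocity γ I s) (N s) = 0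

variable {N : (s : ℝ) → TangentSpace (𝓡 n) (γ s)}

theorem IsUnitNormalField.coordInner_self (hN : IsUnitNormalField g γ I N)
    (hφ : φ ∈ IsManifold.maximalAtlas (𝓡 n) ∞ M) (hs : s ∈ I) (hγs : γ s ∈ φ.source) :
    coordInner g φ (φ (γ s)) (tangentCoord φ (N s)) (tangentCoord φ (N s)) = 1 := by
  rw [← inner_eq_coordInner g hφ hγs, hN.inner_self s hs]

theorem IsUnitNormalField.coordInner_coordVelocity (hN : IsUnitNormalField g γ I N)
    (hγ : IsArclengthCurve g γ I) (hφ : φ ∈ IsManifold.maximalAtlas (𝓡 n) ∞ M) (hs : s ∈ I)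
    (hγs : γ s ∈ φ.source) :
    coordInner g φ (φ (γ s)) (coordVelocity φ γ I s) (tangentCoord φ (N s)) = 0 := by
  rw [coordVelocity_eq_tangentCoord hφ (hγ.uniqueDiffOn s hs) (hγ.smooth s hs) hγs,
    ← inner_eq_coordInner g hφ hγs, hN.inner_velocity s hs]

end UnitNormals

section Frenet

variable {M : Type u} [TopologicalSpace M] [ChartedSpace (EuclideanSpace ℝ (Fin 2)) M]
  [IsManifold (𝓡 2) ∞ M] {g : SmoothRiemannianMetric 2 M}
  {φ : OpenPartialHomeomorph M (EuclideanSpace ℝ (Fin 2))} {γ : ℝ → M} {I : Set ℝ} {s : ℝ}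
  {N : (s : ℝ) → TangentSpace (𝓡 2) (γ s)} {k : ℝ → ℝ}

theorem isGeodesicCurvature_iff : IsGeodesicCurvature g γ I k ↔
    ∃ N, IsUnitNormalField g γ I N ∧ ∀ φ ∈ IsManifold.maximalAtlas (𝓡 2) ∞ M, ∀ s ∈ I,
      γ s ∈ φ.source → coordTension g φ γ I s = k s • tangentCoord φ (N s) :=
  ⟨fun ⟨N, hsmooth, hself, hvel, hτ⟩ =>
    ⟨N, ⟨hsmooth, hself, hvel⟩, fun φ hφ s hs hγs => funext (hτ φ hφ s hs hγs)⟩,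
  fun ⟨N, hN, hτ⟩ => ⟨N, hN.smooth, hN.inner_self, hN.inner_velocity,
    fun φ hφ s hs hγs => congrFun (hτ φ hφ s hs hγs)⟩⟩

theorem covDerivAlong_unitNormal (hγ : IsArclengthCurve g γ I) (hN : IsUnitNormalField g γ I N)
    (hφ : φ ∈ IsManifold.maximalAtlas (𝓡 2) ∞ M) (hs : s ∈ I) (hγs : γ s ∈ φ.source)
    {κ : ℝ} (hτ : coordTension g φ γ I s = κ • tangentCoord φ (N s)) :
    covDerivAlong g φ γ I (fun t => tangentCoord φ (N t)) s = -κ • coordVelocity φ γ I s := by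
  have hsmooth := hγ.smooth s hs
  have hunique := hγ.uniqueDiffOn s hs
  have hev := eventually_mem_and_mem_chart_source hsmooth.continuousWithinAt hγs
  have hT := (contDiffWithinAt_coordVelocity hφ hγ.uniqueDiffOn hs hsmooth
    hγs).differentiableWithinAt (by simp)
  have hν := (contDiffWithinAt_tangentCoord hφ (hN.smooth s hs) hγs).differentiableWithinAt
    (by simp)
  set T := coordVelocity φ γ I
  set ν := fun t => tangentCoord φ (N t)
  set B := coordInner g φ (φ (γ s))
  have hTT : B (T s) (T s) = 1 := hγ.coordInner_coordVelocity_self hφ hs hγs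
  have hTν : B (T s) (ν s) = 0 := hN.coordInner_coordVelocity hγ hφ hs hγs
  have hνν : B (ν s) (ν s) = 1 := hN.coordInner_self hφ hs hγs
  have hνT : B (ν s) (T s) = 0 := (coordInner_comm g _ _ _).trans hTν
  have hnormal : B (covDerivAlong g φ γ I ν s) (ν s) = 0 := by
    have h := coordInner_covDerivAlong_add_of_eventuallyEq_const (g := g) hφ hunique hs hsmooth
      hγs hν hν (hev.mono fun t ht => hN.coordInner_self hφ ht.1 ht.2)
    rw [coordInner_comm g _ (ν s)] at h
    linarith
  have htangent : B (covDerivAlong g φ γ I ν s) (T s) = -κ := by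
    have h := coordInner_covDerivAlong_add_of_eventuallyEq_const (g := g) hφ hunique hs hsmooth
      hγs hT hν (hev.mono fun t ht => hN.coordInner_coordVelocity hγ hφ ht.1 ht.2)
    rw [show covDerivAlong g φ γ I T s = κ • ν s from hτ, coordInner_comm g _ (T s), map_smul,
      LinearMap.smul_apply, smul_eq_mul, hνν] at h
    linarith
  have hexpand := eq_sum_smul_of_orthonormal (B := B) (e := ![T s, ν s])
    (by simp [Fin.forall_fin_two, hTT, hTν, hνν, hνT]) (by simp) (covDerivAlong g φ γ I ν s)
  simpa [htangent, hnormal] using hexpand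

theorem covDerivAlong_covDerivAlong_smul_unitNormal (hγ : IsArclengthCurve g γ I)
    (hN : IsUnitNormalField g γ I N) (hφ : φ ∈ IsManifold.maximalAtlas (𝓡 2) ∞ M) (hs : s ∈ I)
    (hγs : γ s ∈ φ.source)
    (hτ : ∀ t ∈ I, γ t ∈ φ.source → coordTension g φ γ I t = k t • tangentCoord φ (N t))
    {r r' : ℝ → ℝ} {r'' k' : ℝ} (hr : ∀ t ∈ I, HasDerivWithinAt r (r' t) I t)
    (hr' : HasDerivWithinAt r' r'' I s) (hk : HasDerivWithinAt k k' I s) :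
    covDerivAlong g φ γ I (covDerivAlong g φ γ I fun t => r t • tangentCoord φ (N t)) s =
      (r'' - r s * k s ^ 2) • tangentCoord φ (N s) -
        (2 * r' s * k s + r s * k') • coordVelocity φ γ I s := by
  have hev := eventually_mem_and_mem_chart_source (hγ.smooth s hs).continuousWithinAt hγs
  have hunique := hγ.uniqueDiffOn s hs
  have hν {t : ℝ} (ht : t ∈ I ∧ γ t ∈ φ.source) :=
    (contDiffWithinAt_tangentCoord hφ (hN.smooth t ht.1) ht.2).differentiableWithinAt (by simp)
  have hT := (contDiffWithinAt_coordVelocity hφ hγ.uniqueDiffOn hs (hγ.smooth s hs)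
    hγs).differentiableWithinAt (by simp)
  have hfirst : (covDerivAlong g φ γ I fun t => r t • tangentCoord φ (N t)) =ᶠ[nhdsWithin s I]
      fun t => r' t • tangentCoord φ (N t) + (-(r t * k t)) • coordVelocity φ γ I t :=
    hev.mono fun t ht => by
      rw [covDerivAlong_smul (hγ.uniqueDiffOn t ht.1) (hr t ht.1) (hν ht),
        covDerivAlong_unitNormal hγ hN hφ ht.1 ht.2 (hτ t ht.1 ht.2)]
      module
  have hrk := ((hr s hs).fun_mul hk).fun_neg
  rw [covDerivAlong_congr hfirst hs,
    covDerivAlong_add (hr'.differentiableWithinAt.fun_smul (hν ⟨hs, hγs⟩))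
      (hrk.differentiableWithinAt.fun_smul hT),
    covDerivAlong_smul hunique hr' (hν ⟨hs, hγs⟩), covDerivAlong_smul hunique hrk hT,
    covDerivAlong_unitNormal hγ hN hφ hs hγs (hτ s hs hγs),
    show covDerivAlong g φ γ I (coordVelocity φ γ I) s = _ from hτ s hs hγs]
  module

theorem isPBiharmonicCurve_of_isGeodesicCurvature {p K : ℝ} (hK : HasConstantGaussCurvature g K)
    (hγ : IsArclengthCurve g γ I) (hkγ : IsGeodesicCurvature g γ I k) (hk0 : ∀ s ∈ I, k s ≠ 0)
    {k' r r' r'' : ℝ → ℝ} (hk : ∀ s ∈ I, HasDerivWithinAt k (k' s) I s)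
    (hrk : ∀ s ∈ I, r s = |k s| ^ (p - 2) * k s)
    (hr : ∀ s ∈ I, HasDerivWithinAt r (r' s) I s) (hr' : ∀ s ∈ I, HasDerivWithinAt r' (r'' s) I s)
    (hnormal : ∀ s ∈ I, r'' s - r s * k s ^ 2 + K * r s = 0)
    (htangent : ∀ s ∈ I, 2 * r' s * k s + r s * k' s = 0) : IsPBiharmonicCurve p g γ I := by
  obtain ⟨N, hN, hτ⟩ := isGeodesicCurvature_iff.1 hkγ
  intro φ hφ s hs hγs
  have hev := eventually_mem_and_mem_chart_source (hγ.smooth s hs).continuousWithinAt hγs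
  have hνν {t : ℝ} (ht : t ∈ I) (hγt : γ t ∈ φ.source) := hN.coordInner_self hφ ht hγt
  have hpower {t : ℝ} (ht : t ∈ I) (hγt : γ t ∈ φ.source) :
      coordNorm g φ (φ (γ t)) (coordTension g φ γ I t) ^ (p - 2) • coordTension g φ γ I t =
        r t • tangentCoord φ (N t) := by
    rw [hτ φ hφ t ht hγt, coordNorm_smul_of_coordInner_self_eq_one (hνν ht hγt), smul_smul,
      hrk t ht]
  have hcurvature : coordNorm g φ (φ (γ s)) (coordTension g φ γ I s) ^ (p - 2) •
      riemannApply g φ (φ (γ s)) (coordVelocity φ γ I s) (coordTension g φ γ I s)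
        (coordVelocity φ γ I s) = -(K * r s) • tangentCoord φ (N s) := by
    rw [riemannApply_eq_gaussCurvature_smul g hφ (φ.map_source hγs),
      show gaussCurvature g φ (φ (γ s)) = K from hK φ hφ _ (φ.map_source hγs),
      hγ.coordInner_coordVelocity_self hφ hs hγs, hτ φ hφ s hs hγs,
      coordNorm_smul_of_coordInner_self_eq_one (hνν hs hγs), map_smul, LinearMap.smul_apply,
      coordInner_comm, hN.coordInner_coordVelocity hγ hφ hs hγs, hrk s hs]
    module
  constructor
  · rw [hτ φ hφ s hs hγs, Ne, smul_eq_zero, not_or]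
    refine ⟨hk0 s hs, fun hzero => ?_⟩
    simpa [hzero] using hνν hs hγs
  · rw [hcurvature, covDerivAlong_congr
      (covDerivAlong_eventuallyEq (hev.mono fun t ht => hpower ht.1 ht.2)) hs,
      covDerivAlong_covDerivAlong_smul_unitNormal hγ hN hφ hs hγs (hτ φ hφ) hr (hr' s hs) (hk s hs),
      htangent s hs, zero_smul, sub_zero, ← sub_smul, sub_neg_eq_add, hnormal s hs, zero_smul]

end Frenet

section Powers

theorem hasDerivAt_abs_rpow_of_ne_zero {x : ℝ} (hx : x ≠ 0) (q : ℝ) :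
    HasDerivAt (fun x => |x| ^ q) (q * |x| ^ q / x) x := by
  refine ((hasDerivAt_abs hx).rpow_const (.inl (abs_ne_zero.2 hx))).congr_deriv ?_
  rw [Real.rpow_sub_one (abs_ne_zero.2 hx)]
  rcases hx.lt_or_gt with hneg | hpos
  · rw [sign_neg hneg, abs_of_neg hneg, SignType.coe_neg_one]
    field_simp
  · rw [sign_pos hpos, abs_of_pos hpos, SignType.coe_one]
    field_simp

theorem hasDerivAt_abs_rpow_mul_self {x : ℝ} (hx : x ≠ 0) (q : ℝ) :
    HasDerivAt (fun x => |x| ^ q * x) ((q + 1) * |x| ^ q) x :=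
  ((hasDerivAt_abs_rpow_of_ne_zero hx q).fun_mul (hasDerivAt_id' x)).congr_deriv (by field_simp)

end Powers

section HalfBiharmonic

variable {M : Type u} [TopologicalSpace M] [ChartedSpace (EuclideanSpace ℝ (Fin 2)) M]
  [IsManifold (𝓡 2) ∞ M] {g : SmoothRiemannianMetric 2 M} {γ : ℝ → M} {I : Set ℝ} {k : ℝ → ℝ}

theorem SolvesCurvatureODE.isPBiharmonicCurve_half {K : ℝ} (hODE : SolvesCurvatureODE K k)
    (hK : HasConstantGaussCurvature g K) (hγ : IsArclengthCurve g γ I)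
    (hkγ : IsGeodesicCurvature g γ I k) (hk0 : ∀ s ∈ I, k s ≠ 0) :
    IsPBiharmonicCurve (1 / 2) g γ I := by
  obtain ⟨hsmooth, hode⟩ := hODE
  have hk (s : ℝ) : HasDerivAt k (deriv k s) s :=
    (hsmooth.differentiable (by simp) s).hasDerivAt
  have hk' (s : ℝ) : HasDerivAt (deriv k) (deriv (deriv k) s) s :=
    ((hsmooth.iterate_deriv 1).differentiable (by simp) s).hasDerivAt
  refine isPBiharmonicCurve_of_isGeodesicCurvature hK hγ hkγ hk0
    (k' := deriv k) (r := fun s => |k s| ^ (-3 / 2 : ℝ) * k s)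
    (r' := fun s => -1 / 2 * |k s| ^ (-3 / 2 : ℝ) * deriv k s)
    (r'' := fun s => |k s| ^ (-3 / 2 : ℝ) / k s *
      (3 / 4 * deriv k s ^ 2 - 1 / 2 * k s * deriv (deriv k) s))
    (fun s _ => (hk s).hasDerivWithinAt) (fun s _ => by norm_num) (fun s hs => ?_) (fun s hs => ?_)
    (fun s hs => ?_) fun s _ => by ring
  · refine (((hasDerivAt_abs_rpow_mul_self (hk0 s hs) _).comp s (hk s)).congr_deriv
      ?_).hasDerivWithinAt
    ring
  · have hks := hk0 s hs
    refine (((((hasDerivAt_abs_rpow_of_ne_zero (hk0 s hs) _).comp s (hk s)).const_mul _).fun_mul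
      (hk' s)).congr_deriv ?_).hasDerivWithinAt
    simp only [Function.comp_apply]
    field_simp
    ring
  · have hks := hk0 s hs
    calc _ = |k s| ^ (-3 / 2 : ℝ) / k s * (3 / 4 * deriv k s ^ 2 - 1 / 2 * k s * deriv (deriv k) s -
          k s ^ 4 + K * k s ^ 2) := by field_simp
      _ = 0 := by rw [hode, mul_zero]

theorem SolvesCurvatureODE.isProperHalfBiharmonicCurve {K : ℝ} (hODE : SolvesCurvatureODE K k)
    (hK : HasConstantGaussCurvature g K) (hγ : IsArclengthCurve g γ I)
    (hkγ : IsGeodesicCurvature g γ I k) (hk0 : ∀ s ∈ I, k s ≠ 0)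
    (hconst : ∃ s ∈ I, ∃ t ∈ I, k s ≠ k t) : IsProperHalfBiharmonicCurve g γ I :=
  ⟨hODE.isPBiharmonicCurve_half hK hγ hkγ hk0, k, hkγ, hconst⟩

end HalfBiharmonic

section IsometricParametrizations

variable {n : ℕ} {F : Type*} [NormedAddCommGroup F] [InnerProductSpace ℝ F]

theorem partialDeriv_inner (i : Fin n) {X Y : EuclideanSpace ℝ (Fin n) → F}
    {y : EuclideanSpace ℝ (Fin n)} (hX : DifferentiableAt ℝ X y) (hY : DifferentiableAt ℝ Y y) :
    partialDeriv i (fun z => inner ℝ (X z) (Y z)) y =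
      inner ℝ (vectorPartialDeriv i X y) (Y y) + inner ℝ (X y) (vectorPartialDeriv i Y y) := by
  rw [partialDeriv, fderiv_inner_apply ℝ hX hY, add_comm]
  rfl

theorem inner_fderiv_eq_zero_of_inner_vectorPartialDeriv {X : EuclideanSpace ℝ (Fin n) → F}
    {y : EuclideanSpace ℝ (Fin n)} {v : F}
    (hv : ∀ l, inner ℝ v (vectorPartialDeriv l X y) = 0) (u : EuclideanSpace ℝ (Fin n)) :
    inner ℝ v (fderiv ℝ X y u) = 0 := by
  simp [fderiv_apply_eq_sum_vectorPartialDeriv, inner_sum, inner_smul_right, hv]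

variable {M : Type u} [TopologicalSpace M] [ChartedSpace (EuclideanSpace ℝ (Fin n)) M]
  [IsManifold (𝓡 n) ∞ M] {g : SmoothRiemannianMetric n M}
  {φ : OpenPartialHomeomorph M (EuclideanSpace ℝ (Fin n))}
  {X : EuclideanSpace ℝ (Fin n) → F} {y : EuclideanSpace ℝ (Fin n)}

/-- `X` is an isometric immersion into the inner product space `F` of the domain of the chart `φ`,
expressed in the coordinates of `φ`. -/
structure IsIsometricParametrization (g : SmoothRiemannianMetric n M)
    (φ : OpenPartialHomeomorph M (EuclideanSpace ℝ (Fin n)))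
    (X : EuclideanSpace ℝ (Fin n) → F) : Prop where
  contDiffOn : ContDiffOn ℝ ∞ X φ.target
  metricCoeff_eq : ∀ y ∈ φ.target, ∀ i j, metricCoeff g φ y i j =
    inner ℝ (vectorPartialDeriv i X y) (vectorPartialDeriv j X y)

/-- The second fundamental form `∂ᵢ∂ⱼX - ∑ₚ Γᵖᵢⱼ ∂ₚX` of the parametrization `X`, with values in the
ambient space. -/
def secondFundamentalForm (g : SmoothRiemannianMetric n M)
    (φ : OpenPartialHomeomorph M (EuclideanSpace ℝ (Fin n)))
    (X : EuclideanSpace ℝ (Fin n) → F) (i j : Fin n) (y : EuclideanSpace ℝ (Fin n)) : F :=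
  vectorPartialDeriv i (vectorPartialDeriv j X) y -
    ∑ p, christoffel g φ p i j y • vectorPartialDeriv p X y

namespace IsIsometricParametrization

theorem differentiableAt_vectorPartialDeriv (hX : IsIsometricParametrization g φ X)
    (hy : y ∈ φ.target) (i : Fin n) : DifferentiableAt ℝ (vectorPartialDeriv i X) y :=
  ((contDiffOn_vectorPartialDeriv hX.contDiffOn φ.open_target i).contDiffAt
    (φ.open_target.mem_nhds hy)).differentiableAt (by simp)

theorem differentiableAt_vectorPartialDeriv_vectorPartialDeriv
    (hX : IsIsometricParametrization g φ X) (hy : y ∈ φ.target) (i j : Fin n) :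
    DifferentiableAt ℝ (vectorPartialDeriv i (vectorPartialDeriv j X)) y :=
  ((contDiffOn_vectorPartialDeriv (contDiffOn_vectorPartialDeriv hX.contDiffOn φ.open_target j)
    φ.open_target i).contDiffAt (φ.open_target.mem_nhds hy)).differentiableAt (by simp)

theorem vectorPartialDeriv_comm (hX : IsIsometricParametrization g φ X) (hy : y ∈ φ.target)
    (i j : Fin n) : vectorPartialDeriv i (vectorPartialDeriv j X) y =
      vectorPartialDeriv j (vectorPartialDeriv i X) y :=
  _root_.vectorPartialDeriv_comm ((hX.contDiffOn.contDiffAt (φ.open_target.mem_nhds hy)).of_le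
    (by norm_cast)) i j

theorem christoffelFirst_eq_inner (hX : IsIsometricParametrization g φ X) (hy : y ∈ φ.target)
    (a i j : Fin n) : christoffelFirst g φ a i j y =
      inner ℝ (vectorPartialDeriv i (vectorPartialDeriv j X) y) (vectorPartialDeriv a X y) := by
  have hmetric (m i j : Fin n) : partialDeriv m (fun z => metricCoeff g φ z i j) y =
      inner ℝ (vectorPartialDeriv m (vectorPartialDeriv i X) y) (vectorPartialDeriv j X y) +
        inner ℝ (vectorPartialDeriv m (vectorPartialDeriv j X) y) (vectorPartialDeriv i X y) := by
    rw [partialDeriv_congr m ((φ.open_target.eventually_mem hy).mono fun z hz =>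
      hX.metricCoeff_eq z hz i j),
      partialDeriv_inner m (hX.differentiableAt_vectorPartialDeriv hy i)
        (hX.differentiableAt_vectorPartialDeriv hy j), real_inner_comm _ (vectorPartialDeriv i X y)]
  rw [christoffelFirst, hmetric, hmetric, hmetric, hX.vectorPartialDeriv_comm hy j i,
    hX.vectorPartialDeriv_comm hy a i, hX.vectorPartialDeriv_comm hy a j]
  ring

theorem inner_secondFundamentalForm_vectorPartialDeriv (hX : IsIsometricParametrization g φ X)
    (hφ : φ ∈ IsManifold.maximalAtlas (𝓡 n) ∞ M) (hy : y ∈ φ.target) (i j l : Fin n) :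
    inner ℝ (secondFundamentalForm g φ X i j y) (vectorPartialDeriv l X y) = 0 := by
  rw [secondFundamentalForm, inner_sub_left, ← hX.christoffelFirst_eq_inner hy,
    ← sum_metricCoeff_mul_christoffel g hφ hy, sum_inner, sub_eq_zero]
  refine Finset.sum_congr rfl fun p _ => ?_
  rw [real_inner_smul_left, ← hX.metricCoeff_eq y hy, metricCoeff_comm, mul_comm]

theorem inner_vectorPartialDeriv_vectorPartialDeriv (hX : IsIsometricParametrization g φ X)
    (hφ : φ ∈ IsManifold.maximalAtlas (𝓡 n) ∞ M) (hy : y ∈ φ.target) (i j k l : Fin n) :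
    inner ℝ (vectorPartialDeriv i (vectorPartialDeriv j X) y)
        (vectorPartialDeriv k (vectorPartialDeriv l X) y) =
      inner ℝ (secondFundamentalForm g φ X i j y) (secondFundamentalForm g φ X k l y) +
        ∑ p, christoffelFirst g φ p i j y * christoffel g φ p k l y := by
  have hkl : vectorPartialDeriv k (vectorPartialDeriv l X) y = secondFundamentalForm g φ X k l y +
      ∑ p, christoffel g φ p k l y • vectorPartialDeriv p X y := (sub_add_cancel _ _).symm
  have hij : inner ℝ (vectorPartialDeriv i (vectorPartialDeriv j X) y)
      (secondFundamentalForm g φ X k l y) =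
        inner ℝ (secondFundamentalForm g φ X i j y) (secondFundamentalForm g φ X k l y) := by
    rw [secondFundamentalForm.eq_def g φ X i j, inner_sub_left, sum_inner,
      Finset.sum_eq_zero fun p _ => ?_, sub_zero]
    rw [real_inner_smul_left, real_inner_comm,
      hX.inner_secondFundamentalForm_vectorPartialDeriv hφ hy, mul_zero]
  rw [hkl, inner_add_right, hij, inner_sum]
  simp only [real_inner_smul_right, hX.christoffelFirst_eq_inner hy, mul_comm]

theorem riemannLower_eq (hX : IsIsometricParametrization g φ X)
    (hφ : φ ∈ IsManifold.maximalAtlas (𝓡 n) ∞ M) (hy : y ∈ φ.target) (a i j k : Fin n) :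
    riemannLower g φ a i j k y =
      inner ℝ (secondFundamentalForm g φ X i a y) (secondFundamentalForm g φ X j k y) -
        inner ℝ (secondFundamentalForm g φ X j a y) (secondFundamentalForm g φ X i k y) := by
  have hderiv (i j : Fin n) : partialDeriv i (christoffelFirst g φ a j k) y =
      inner ℝ (vectorPartialDeriv i (vectorPartialDeriv j (vectorPartialDeriv k X)) y)
          (vectorPartialDeriv a X y) +
        inner ℝ (vectorPartialDeriv i (vectorPartialDeriv a X) y)
          (vectorPartialDeriv j (vectorPartialDeriv k X) y) := by
    rw [partialDeriv_congr i ((φ.open_target.eventually_mem hy).mono fun z hz =>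
      hX.christoffelFirst_eq_inner hz a j k), partialDeriv_inner i
      (hX.differentiableAt_vectorPartialDeriv_vectorPartialDeriv hy j k)
      (hX.differentiableAt_vectorPartialDeriv hy a),
      real_inner_comm (vectorPartialDeriv i (vectorPartialDeriv a X) y)]
  have hthird := _root_.vectorPartialDeriv_comm (((contDiffOn_vectorPartialDeriv hX.contDiffOn
    φ.open_target k).contDiffAt (φ.open_target.mem_nhds hy)).of_le (by norm_cast)) i j
  rw [_root_.riemannLower_eq g hφ hy, hderiv, hderiv, hthird,
    hX.inner_vectorPartialDeriv_vectorPartialDeriv hφ hy,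
    hX.inner_vectorPartialDeriv_vectorPartialDeriv hφ hy, Finset.sum_sub_distrib]
  ring

theorem secondFundamentalForm_eq_zero (hX : IsIsometricParametrization g φ X)
    (hφ : φ ∈ IsManifold.maximalAtlas (𝓡 n) ∞ M) (hy : y ∈ φ.target)
    (hsurj : Function.Surjective (fderiv ℝ X y)) (i j : Fin n) :
    secondFundamentalForm g φ X i j y = 0 := by
  obtain ⟨u, hu⟩ := hsurj (secondFundamentalForm g φ X i j y)
  rw [← inner_self_eq_zero (𝕜 := ℝ)]
  nth_rewrite 2 [← hu]
  exact inner_fderiv_eq_zero_of_inner_vectorPartialDeriv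
    (hX.inner_secondFundamentalForm_vectorPartialDeriv hφ hy i j) u

theorem inner_vectorPartialDeriv_of_norm_eq_one (hX : IsIsometricParametrization g φ X)
    (hnorm : ∀ z ∈ φ.target, ‖X z‖ = 1) (hy : y ∈ φ.target) (l : Fin n) :
    inner ℝ (X y) (vectorPartialDeriv l X y) = 0 := by
  have hdiff : DifferentiableAt ℝ X y :=
    (hX.contDiffOn.contDiffAt (φ.open_target.mem_nhds hy)).differentiableAt (by simp)
  have hconst : (fun z => inner ℝ (X z) (X z)) =ᶠ[nhds y] fun _ => (1 : ℝ) :=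
    (φ.open_target.eventually_mem hy).mono fun z hz =>
      (real_inner_self_eq_norm_sq _).trans (by rw [hnorm z hz, one_pow])
  have h := partialDeriv_inner l hdiff hdiff
  rw [partialDeriv_congr l hconst, real_inner_comm (X y), partialDeriv, fderiv_fun_const] at h
  exact self_eq_neg.1 (neg_eq_of_add_eq_zero_right h.symm).symm

theorem secondFundamentalForm_eq_neg_smul (hX : IsIsometricParametrization g φ X)
    (hφ : φ ∈ IsManifold.maximalAtlas (𝓡 n) ∞ M) (hnorm : ∀ z ∈ φ.target, ‖X z‖ = 1)
    (hy : y ∈ φ.target)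
    (hrange : ∀ v : F, inner ℝ (X y) v = 0 → v ∈ Set.range (fderiv ℝ X y)) (i j : Fin n) :
    secondFundamentalForm g φ X i j y = -(metricCoeff g φ y i j • X y) := by
  have horth (z) (hz : z ∈ φ.target) := hX.inner_vectorPartialDeriv_of_norm_eq_one hnorm hz
  have hII : inner ℝ (X y) (secondFundamentalForm g φ X i j y) = -metricCoeff g φ y i j := by
    have hdiff : DifferentiableAt ℝ X y :=
      (hX.contDiffOn.contDiffAt (φ.open_target.mem_nhds hy)).differentiableAt (by simp)
    have h := partialDeriv_inner i hdiff (hX.differentiableAt_vectorPartialDeriv hy j)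
    rw [partialDeriv_congr i ((φ.open_target.eventually_mem hy).mono fun z hz => horth z hz j),
      partialDeriv, fderiv_fun_const, ← hX.metricCoeff_eq y hy] at h
    simp only [secondFundamentalForm, inner_sub_right, inner_sum, real_inner_smul_right,
      horth y hy, mul_zero, Finset.sum_const_zero, sub_zero]
    simpa using (neg_eq_of_add_eq_zero_right h.symm).symm
  rw [← add_eq_zero_iff_eq_neg]
  obtain ⟨u, hu⟩ := hrange (secondFundamentalForm g φ X i j y + metricCoeff g φ y i j • X y) (by
    rw [inner_add_right, hII, real_inner_smul_right, real_inner_self_eq_norm_sq, hnorm y hy]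
    ring)
  rw [← inner_self_eq_zero (𝕜 := ℝ)]
  nth_rewrite 2 [← hu]
  refine inner_fderiv_eq_zero_of_inner_vectorPartialDeriv (fun l => ?_) u
  rw [inner_add_left, hX.inner_secondFundamentalForm_vectorPartialDeriv hφ hy,
    real_inner_smul_left, horth y hy, mul_zero, add_zero]

end IsIsometricParametrization

end IsometricParametrizations

section ModelSurfaces

theorem isIsometricParametrization_symm_flatMetric
    {φ : OpenPartialHomeomorph (EuclideanSpace ℝ (Fin 2)) (EuclideanSpace ℝ (Fin 2))}
    (hφ : φ ∈ IsManifold.maximalAtlas (𝓡 2) ∞ (EuclideanSpace ℝ (Fin 2))) :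
    IsIsometricParametrization flatMetric φ φ.symm where
  contDiffOn := contMDiffOn_iff_contDiffOn.1 (contMDiffOn_symm_of_mem_maximalAtlas hφ)
  metricCoeff_eq y _ i j := by
    simp only [metricCoeff, Matrix.of_apply, coordField, mfderiv_eq_fderiv]
    rfl

theorem hasConstantGaussCurvature_flatMetric : HasConstantGaussCurvature flatMetric 0 := by
  refine (hasConstantGaussCurvature_iff _).2 fun φ hφ y hy => ?_
  have hX := isIsometricParametrization_symm_flatMetric hφ
  have hsurj : Function.Surjective (fderiv ℝ φ.symm y) := by
    rw [← mfderiv_eq_fderiv]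
    exact (mdifferentiable_of_mem_maximalAtlas hφ).symm.mfderiv_surjective hy
  simp only [gaussCurvature, hX.riemannLower_eq hφ hy,
    hX.secondFundamentalForm_eq_zero hφ hy hsurj, inner_zero_left, sub_zero, zero_div]

variable {φ : OpenPartialHomeomorph TwoSphere (EuclideanSpace ℝ (Fin 2))}

theorem contMDiff_coe_twoSphere : ContMDiff (𝓡 2) 𝓘(ℝ, EuclideanSpace ℝ (Fin 3)) ∞
    ((↑) : TwoSphere → EuclideanSpace ℝ (Fin 3)) :=
  have := Fact.mk (@finrank_euclideanSpace_fin ℝ _ (2 + 1))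
  contMDiff_coe_sphere (n := 2)

theorem fderiv_coe_symm_twoSphere (hφ : φ ∈ IsManifold.maximalAtlas (𝓡 2) ∞ TwoSphere)
    {y : EuclideanSpace ℝ (Fin 2)} (hy : y ∈ φ.target) (u : EuclideanSpace ℝ (Fin 2)) :
    fderiv ℝ (fun z => (φ.symm z : EuclideanSpace ℝ (Fin 3))) y u =
      sphereInclusionDeriv (φ.symm y) (mfderiv (𝓡 2) (𝓡 2) φ.symm y u) := by
  rw [← mfderiv_eq_fderiv]
  exact congrArg (fun L => L u) (mfderiv_comp y
    (contMDiff_coe_twoSphere.mdifferentiableAt (by simp))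
    ((mdifferentiable_of_mem_maximalAtlas hφ).mdifferentiableAt_symm hy))

theorem isIsometricParametrization_coe_symm_roundMetric
    (hφ : φ ∈ IsManifold.maximalAtlas (𝓡 2) ∞ TwoSphere) :
    IsIsometricParametrization roundMetric φ
      (fun y => (φ.symm y : EuclideanSpace ℝ (Fin 3))) where
  contDiffOn := contMDiffOn_iff_contDiffOn.1
    (contMDiff_coe_twoSphere.comp_contMDiffOn (contMDiffOn_symm_of_mem_maximalAtlas hφ))
  metricCoeff_eq y hy i j := by
    rw [vectorPartialDeriv, vectorPartialDeriv, fderiv_coe_symm_twoSphere hφ hy,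
      fderiv_coe_symm_twoSphere hφ hy]
    rfl

theorem mem_range_fderiv_coe_symm_twoSphere
    (hφ : φ ∈ IsManifold.maximalAtlas (𝓡 2) ∞ TwoSphere) {y : EuclideanSpace ℝ (Fin 2)}
    (hy : y ∈ φ.target) {v : EuclideanSpace ℝ (Fin 3)}
    (hv : inner ℝ (φ.symm y : EuclideanSpace ℝ (Fin 3)) v = 0) :
    v ∈ Set.range (fderiv ℝ (fun z => (φ.symm z : EuclideanSpace ℝ (Fin 3))) y) := by
  have := Fact.mk (@finrank_euclideanSpace_fin ℝ _ (2 + 1))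
  have hvr : v ∈ (mvfderiv (𝓡 2) ((↑) : TwoSphere → EuclideanSpace ℝ (Fin 3))
      (φ.symm y)).range := by
    rw [range_mvfderiv_subtypeVal (n := 2) (φ.symm y)]
    exact Submodule.mem_orthogonal_singleton_iff_inner_right.2 hv
  obtain ⟨w, hw⟩ := hvr
  obtain ⟨u, rfl⟩ := (mdifferentiable_of_mem_maximalAtlas hφ).symm.mfderiv_surjective hy w
  exact ⟨u, (fderiv_coe_symm_twoSphere hφ hy u).trans hw⟩

theorem hasConstantGaussCurvature_roundMetric : HasConstantGaussCurvature roundMetric 1 := by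
  refine (hasConstantGaussCurvature_iff _).2 fun φ hφ y hy => ?_
  have hX := isIsometricParametrization_coe_symm_roundMetric hφ
  have hII := hX.secondFundamentalForm_eq_neg_smul hφ (fun z _ => norm_eq_of_mem_sphere _) hy
    fun _ => mem_range_fderiv_coe_symm_twoSphere hφ hy
  have hself : inner ℝ (φ.symm y : EuclideanSpace ℝ (Fin 3)) (φ.symm y) = 1 := by
    rw [real_inner_self_eq_norm_sq, norm_eq_of_mem_sphere, one_pow]
  rw [gaussCurvature, div_eq_one_iff_eq (posDef_metricCoeff roundMetric hφ hy).det_pos.ne',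
    hX.riemannLower_eq hφ hy, Matrix.det_fin_two]
  simp only [hII, inner_neg_neg, real_inner_smul_left, real_inner_smul_right, hself]
  ring

end ModelSurfaces

section CurvatureFunctions

/-- `D` is a nowhere vanishing solution of `½ D D'' - ¼ D'² + K D² = a²`, with derivatives `D'` and
`D''` that never vanish together. The substitution `k = a / D` turns the curvature equation into
this first integral. -/
structure IsCurvatureDenominator (K a : ℝ) (D D' D'' : ℝ → ℝ) : Prop where
  contDiff : ContDiff ℝ ∞ D
  ne_zero : ∀ s, D s ≠ 0
  hasDerivAt : ∀ s, HasDerivAt D (D' s) s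
  hasDerivAt_deriv : ∀ s, HasDerivAt D' (D'' s) s
  first_integral : ∀ s, 1 / 2 * D s * D'' s - 1 / 4 * D' s ^ 2 + K * D s ^ 2 = a ^ 2
  deriv_ne_zero : ∀ s, D' s = 0 → D'' s ≠ 0

namespace IsCurvatureDenominator

variable {K a : ℝ} {D D' D'' : ℝ → ℝ}

theorem solvesCurvatureODE (h : IsCurvatureDenominator K a D D' D'') :
    SolvesCurvatureODE K (fun s => a / D s) := by
  have hderiv : deriv (fun s => a / D s) = fun s => -(a * D' s) / D s ^ 2 := by
    ext s
    rw [((hasDerivAt_const s a).fun_div (h.hasDerivAt s) (h.ne_zero s)).deriv]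
    ring
  have hderiv2 (s : ℝ) : deriv (deriv fun s => a / D s) s =
      -(a * D'' s) / D s ^ 2 + 2 * a * D' s ^ 2 / D s ^ 3 := by
    have hD := h.ne_zero s
    rw [hderiv, (((h.hasDerivAt_deriv s).const_mul a).fun_neg.fun_div
      ((h.hasDerivAt s).fun_pow 2) (pow_ne_zero 2 hD)).deriv]
    field_simp
    ring
  refine ⟨contDiff_const.div h.contDiff h.ne_zero, fun s => ?_⟩
  have hD := h.ne_zero s
  rw [hderiv2, hderiv]
  field_simp
  linear_combination 8 * a ^ 2 * h.first_integral s

theorem exists_ne (h : IsCurvatureDenominator K a D D' D'') {I : Set ℝ} (hI : I.OrdConnected)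
    (hI' : I.Nontrivial) : ∃ s ∈ I, ∃ t ∈ I, D s ≠ D t := by
  by_contra! hconst
  obtain ⟨s, hs, t, ht, hst⟩ := hI'.exists_lt
  have hD : ∀ x ∈ Set.Ioo s t, D' x = 0 := fun x hx => by
    have hx' : D =ᶠ[nhds x] fun _ => D s := by
      filter_upwards [Ioo_mem_nhds hx.1 hx.2] with y hy
      exact hconst y (hI.out hs ht (Set.Ioo_subset_Icc_self hy)) s hs
    exact (h.hasDerivAt x).unique ((hasDerivAt_const x (D s)).congr_of_eventuallyEq hx')
  obtain ⟨x, hx⟩ := Set.nonempty_Ioo.2 hst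
  have hx' : D' =ᶠ[nhds x] fun _ => 0 := by
    filter_upwards [Ioo_mem_nhds hx.1 hx.2] with y hy using hD y hy
  exact h.deriv_ne_zero x (hD x hx)
    ((h.hasDerivAt_deriv x).unique ((hasDerivAt_const x 0).congr_of_eventuallyEq hx'))

theorem isProperHalfBiharmonicCurve (h : IsCurvatureDenominator K a D D' D'') (ha : a ≠ 0)
    {M : Type u} [TopologicalSpace M] [ChartedSpace (EuclideanSpace ℝ (Fin 2)) M]
    [IsManifold (𝓡 2) ∞ M] {g : SmoothRiemannianMetric 2 M} (hK : HasConstantGaussCurvature g K)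
    {γ : ℝ → M} {I : Set ℝ} (hγ : IsArclengthCurve g γ I)
    (hkγ : IsGeodesicCurvature g γ I fun s => a / D s) : IsProperHalfBiharmonicCurve g γ I := by
  obtain ⟨s, hs, t, ht, hst⟩ := h.exists_ne hγ.ordConnected hγ.nontrivial
  exact h.solvesCurvatureODE.isProperHalfBiharmonicCurve hK hγ hkγ
    (fun s _ => div_ne_zero ha (h.ne_zero s))
    ⟨s, hs, t, ht, by simpa [div_eq_mul_inv, ha] using hst⟩

end IsCurvatureDenominator

theorem isCurvatureDenominator_flat {c₁ : ℝ} (hc : c₁ ≠ 0) (c₂ : ℝ) :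
    IsCurvatureDenominator 0 c₁ (fun s => c₁ ^ 2 * (c₂ + s) ^ 2 + 1)
      (fun s => 2 * c₁ ^ 2 * (c₂ + s)) (fun _ => 2 * c₁ ^ 2) where
  contDiff := by fun_prop
  ne_zero s := by positivity
  hasDerivAt s := by
    refine (((((hasDerivAt_id' s).const_add c₂).fun_pow 2).const_mul (c₁ ^ 2)).add_const
      1).congr_deriv ?_
    ring
  hasDerivAt_deriv s := by
    simpa using ((hasDerivAt_id' s).const_add c₂).const_mul (2 * c₁ ^ 2)
  first_integral s := by ring
  deriv_ne_zero s _ := by positivity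

theorem hasDerivAt_two_mul_const_add (c s : ℝ) : HasDerivAt (fun s => 2 * (c + s)) 2 s := by
  simpa using ((hasDerivAt_id' s).const_add c).const_mul (2 : ℝ)

theorem add_mul_sin_ne_zero {b w : ℝ} (h : w ^ 2 < b ^ 2) (x : ℝ) : b + w * Real.sin x ≠ 0 := by
  intro h0
  have hb : b ^ 2 = w ^ 2 * Real.sin x ^ 2 := by
    rw [← mul_pow, eq_neg_of_add_eq_zero_left h0, neg_sq]
  exact h.not_ge (hb ▸ mul_le_of_le_one_right (sq_nonneg w) (Real.sin_sq_le_one x))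

theorem isCurvatureDenominator_sphere {c₁ : ℝ} (hc : 4 < c₁ ^ 2) (c₃ : ℝ) :
    IsCurvatureDenominator 1 2
      (fun s => c₁ + Real.sqrt (c₁ ^ 2 - 4) * Real.sin (2 * (c₃ + s)))
      (fun s => 2 * Real.sqrt (c₁ ^ 2 - 4) * Real.cos (2 * (c₃ + s)))
      (fun s => -(4 * Real.sqrt (c₁ ^ 2 - 4) * Real.sin (2 * (c₃ + s)))) := by
  have hw : 0 < Real.sqrt (c₁ ^ 2 - 4) := Real.sqrt_pos.2 (sub_pos.2 hc)
  have hw2 : Real.sqrt (c₁ ^ 2 - 4) ^ 2 = c₁ ^ 2 - 4 := Real.sq_sqrt (sub_pos.2 hc).le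
  set w := Real.sqrt (c₁ ^ 2 - 4)
  refine ⟨by fun_prop, fun s => add_mul_sin_ne_zero (by linarith) _, fun s => ?_, fun s => ?_,
    fun s => ?_, fun s hcos hsin => ?_⟩
  · refine (((hasDerivAt_two_mul_const_add c₃ s).sin.const_mul w).const_add c₁).congr_deriv ?_
    ring
  · refine ((hasDerivAt_two_mul_const_add c₃ s).cos.const_mul (2 * w)).congr_deriv ?_
    ring
  · linear_combination -w ^ 2 * Real.sin_sq_add_cos_sq (2 * (c₃ + s)) - hw2
  · have hcos' : Real.cos (2 * (c₃ + s)) = 0 := by simpa [hw.ne'] using hcos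
    have hsin' : Real.sin (2 * (c₃ + s)) = 0 := by simpa [hw.ne'] using hsin
    simpa [hcos', hsin'] using Real.sin_sq_add_cos_sq (2 * (c₃ + s))

theorem add_exp_neg_sub_add_exp_eq (c x : ℝ) :
    (c ^ 2 + 4) * Real.exp (-x) - 2 * c + Real.exp x =
      ((c - Real.exp x) ^ 2 + 4) / Real.exp x := by
  rw [Real.exp_neg]
  field_simp
  ring

theorem isCurvatureDenominator_hyperbolic (c₁ c₄ : ℝ) :
    IsCurvatureDenominator (-1) 4
      (fun s => (c₁ ^ 2 + 4) * Real.exp (-(2 * (c₄ + s))) - 2 * c₁ + Real.exp (2 * (c₄ + s)))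
      (fun s => -2 * (c₁ ^ 2 + 4) * Real.exp (-(2 * (c₄ + s))) + 2 * Real.exp (2 * (c₄ + s)))
      (fun s => 4 * (c₁ ^ 2 + 4) * Real.exp (-(2 * (c₄ + s))) +
        4 * Real.exp (2 * (c₄ + s))) where
  contDiff := by fun_prop
  ne_zero s := by
    rw [add_exp_neg_sub_add_exp_eq]
    positivity
  hasDerivAt s := by
    refine (((hasDerivAt_two_mul_const_add c₄ s).fun_neg.exp.const_mul (c₁ ^ 2 + 4)).sub_const
      (2 * c₁)).fun_add (hasDerivAt_two_mul_const_add c₄ s).exp |>.congr_deriv ?_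
    ring
  hasDerivAt_deriv s := by
    refine ((hasDerivAt_two_mul_const_add c₄ s).fun_neg.exp.const_mul (-2 * (c₁ ^ 2 + 4))).fun_add
      ((hasDerivAt_two_mul_const_add c₄ s).exp.const_mul 2) |>.congr_deriv ?_
    ring
  first_integral s := by
    have hprod : Real.exp (-(2 * (c₄ + s))) * Real.exp (2 * (c₄ + s)) = 1 := by
      rw [← Real.exp_add, neg_add_cancel, Real.exp_zero]
    linear_combination 4 * (c₁ ^ 2 + 4) * hprod
  deriv_ne_zero s _ := by positivity

theorem four_mul_exp_div_eq (c x : ℝ) :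
    4 * Real.exp x / ((c - Real.exp x) ^ 2 + 4) =
      4 / ((c ^ 2 + 4) * Real.exp (-x) - 2 * c + Real.exp x) := by
  rw [add_exp_neg_sub_add_exp_eq, div_div_eq_mul_div]

end CurvatureFunctions

theorem mainTheorem1_general {M : Type u} [TopologicalSpace M]
    [ChartedSpace (EuclideanSpace ℝ (Fin 2)) M] [IsManifold (𝓡 2) ∞ M]
    (g : SmoothRiemannianMetric 2 M) {γ : ℝ → M} {I : Set ℝ} (hγ : IsArclengthCurve g γ I)
    (k : ℝ → ℝ) :
    (HasConstantGaussCurvature g 0 → ∀ c₁ c₂ : ℝ, c₁ ≠ 0 →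
      (∀ s, k s = c₁ / (c₁ ^ 2 * (c₂ + s) ^ 2 + 1)) →
      SolvesCurvatureODE 0 k ∧
        (IsGeodesicCurvature g γ I k → IsProperHalfBiharmonicCurve g γ I)) ∧
    (HasConstantGaussCurvature g 1 → ∀ c₁ c₃ : ℝ, 4 < c₁ ^ 2 →
      (∀ s, k s = 2 / (c₁ + Real.sqrt (c₁ ^ 2 - 4) * Real.sin (2 * (c₃ + s)))) →
      SolvesCurvatureODE 1 k ∧
        (IsGeodesicCurvature g γ I k → IsProperHalfBiharmonicCurve g γ I)) ∧
    (HasConstantGaussCurvature g (-1) → ∀ c₁ c₄ : ℝ,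
      (∀ s, k s = 4 * Real.exp (2 * (c₄ + s)) / ((c₁ - Real.exp (2 * (c₄ + s))) ^ 2 + 4)) →
      SolvesCurvatureODE (-1) k ∧
        (IsGeodesicCurvature g γ I k → IsProperHalfBiharmonicCurve g γ I)) := by
  refine ⟨fun hK c₁ c₂ hc hk => ?_, fun hK c₁ c₃ hc hk => ?_, fun hK c₁ c₄ hk => ?_⟩
  · have hD := isCurvatureDenominator_flat hc c₂
    obtain rfl := funext hk
    exact ⟨hD.solvesCurvatureODE, hD.isProperHalfBiharmonicCurve hc hK hγ⟩
  · have hD := isCurvatureDenominator_sphere hc c₃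
    obtain rfl := funext hk
    exact ⟨hD.solvesCurvatureODE, hD.isProperHalfBiharmonicCurve two_ne_zero hK hγ⟩
  · have hD := isCurvatureDenominator_hyperbolic c₁ c₄
    obtain rfl := funext fun s => (hk s).trans (four_mul_exp_div_eq c₁ _)
    exact ⟨hD.solvesCurvatureODE, hD.isProperHalfBiharmonicCurve four_ne_zero hK hγ⟩

end

theorem mainTheorem1 :
    -- the Euclidean plane
    (∀ (γ : ℝ → EuclideanSpace ℝ (Fin 2)) (I : Set ℝ) (c₁ c₂ : ℝ) (k : ℝ → ℝ),
      IsArclengthCurve flatMetric γ I → c₁ ≠ 0 →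
      (∀ s, k s = c₁ / (c₁ ^ 2 * (c₂ + s) ^ 2 + 1)) →
      SolvesCurvatureODE 0 k ∧
        (IsGeodesicCurvature flatMetric γ I k → IsProperHalfBiharmonicCurve flatMetric γ I)) ∧
    -- the round sphere
    (∀ (γ : ℝ → TwoSphere) (I : Set ℝ) (c₁ c₃ : ℝ) (k : ℝ → ℝ),
      IsArclengthCurve roundMetric γ I → 4 < c₁ ^ 2 →
      (∀ s, k s = 2 / (c₁ + Real.sqrt (c₁ ^ 2 - 4) * Real.sin (2 * (c₃ + s)))) →
      SolvesCurvatureODE 1 k ∧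
        (IsGeodesicCurvature roundMetric γ I k → IsProperHalfBiharmonicCurve roundMetric γ I)) ∧
    -- hyperbolic surfaces
    (∀ (M : Type u) [TopologicalSpace M] [ChartedSpace (EuclideanSpace ℝ (Fin 2)) M]
      [IsManifold (𝓡 2) ∞ M] (g : SmoothRiemannianMetric 2 M),
      HasConstantGaussCurvature g (-1) →
      ∀ (γ : ℝ → M) (I : Set ℝ) (c₁ c₄ : ℝ) (k : ℝ → ℝ),
      IsArclengthCurve g γ I →
      (∀ s, k s = 4 * Real.exp (2 * (c₄ + s)) /
        ((c₁ - Real.exp (2 * (c₄ + s))) ^ 2 + 4)) →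
      SolvesCurvatureODE (-1) k ∧
        (IsGeodesicCurvature g γ I k → IsProperHalfBiharmonicCurve g γ I)) :=
  ⟨fun _ _ c₁ c₂ k hγ => (mainTheorem1_general _ hγ k).1 hasConstantGaussCurvature_flatMetric c₁ c₂,
    fun _ _ c₁ c₃ k hγ =>
      (mainTheorem1_general _ hγ k).2.1 hasConstantGaussCurvature_roundMetric c₁ c₃,
    fun _ _ _ _ g hK _ _ c₁ c₄ k hγ => (mainTheorem1_general g hγ k).2.2 hK c₁ c₄⟩
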